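/- Let $B(x,y)=x_1y_1+x_2y_2-x_3y_3$ on $\mathbb R^3=\mathbb R^2_1$, let $\mathbb H^2=\{x: B(x,x)=-1,\ x_3>0\}$ with distance $\cosh d(x,y)=-B(x,y)$ and the orientation in which $(v,w)$ is a positive frame of $T_y\mathbb H^2$ when $\det(y,v,w)>0$, and let $\mathrm{SO}^o(2,1)$ be the group of linear maps of determinant one preserving $B$ and $\mathbb H^2$. For a hyperbolic $h\in \mathrm{SO}^o(2,1)$ (three distinct real eigenvalues) let $X_h^-,X_h^+$ be the future-pointing null eigenvectors of Euclidean norm one for its smallest and largest eigenvalue, and $X_h^0$ the fixed vector with $B(X^0_h,X^0_h)=1$ and $\det(X^0_h,X^-_h,X^+_h)>0$. The axis of $h$ is $\mathbb H^2\cap (X_h^0)^\perp$, oriented from $X_h^-$ to $X_h^+$, and $\ell(h)=\inf_{x\in\mathbb H^2} d(x,hx)$ is its translation length. Let $G\subset \mathrm{SO}^o(2,1)$ be a finitely generated discrete group all of whose nontrivial elements are hyperbolic and whose quotient surface $S=\mathbb H^2/G$ is not compact (it has at least one hole). A cocycle is a map $u:G\to\mathbb R^2_1$ with $u(g_1g_2)=g_1u(g_2)+u(g_1)$.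 Let $h\in G$ represent a simple closed geodesic (not a proper power, and any two lifts to $\mathbb H^2$ equal or disjoint) that separates $S$. Let $\Sigma_{\mathrm L}(h),\Sigma_{\mathrm R}(h)\subset G$ be the stabilizers of those components of the complement in $\mathbb H^2$ of all lifts of this geodesic which border the axis of $h$ on its left, respectively right; they are the fundamental groups of the two parts of $S$. The affine twist cocycle $\mathbf{AT}_h$ along $h$ is the cocycle with $\mathbf{AT}_h(g)=0$ for $g\in\Sigma_{\mathrm R}(h)$ and $\mathbf{AT}_h(g)=X^0_h-gX^0_h$ for $g\in\Sigma_{\mathrm L}(h)$. Identify $v\in\mathbb R^2_1$ with $\begin{pmatrix}v_1&v_2-v_3\\ v_2+v_3&-v_1\end{pmatrix}\in\mathfrak{sl}_2(\mathbb R)$, so that $B(v,w)=\tfrac12\mathrm{tr}(vw)$, and let $\mathrm{ad}(v)$ be the resulting endomorphism $w\mapsto[v,w]$ of $\mathbb R^2_1$. A deformation along a cocycle $u$ is a family of homomorphisms $\rho_t:G\to \mathrm{SO}^o(2,1)$, $t\in\mathbb R$, with $\rho_0$ the inclusion and $\frac{d}{dt}\big|_{t=0}\rho_t(g)=\mathrm{ad}(u(g))\,g$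 for all $g\in G$. Let $h_1,\dots,h_s\in G$ represent simple separating closed geodesics of $S$ that are pairwise disjoint. Then the affine twist cocycles $\mathbf{AT}_{h_k}$ exist and are unique. Moreover, let $\tau_1,\dots,\tau_s\in\mathbb R$, let $\mathbf{at}=\sum_{k=1}^s\tau_k\mathbf{AT}_{h_k}$, let $\rho_t$ be any deformation along $\mathbf{at}$, and let $\sigma\in G$, $\sigma\ne1$, be any geodesic loop. Then $\sigma$ meets each $h_k$ transversely only finitely often, and $\ell_\sigma(t)=\ell(\rho_t(\sigma))$ is differentiable at $t=0$ with $$\left.\frac{d\ell_\sigma}{dt}\right|_{t=0}=2\sum_{k=1}^s\tau_k\sum_{p\in h_k\cap\sigma}\cos(\theta_{h_k}^{\sigma})_p .$$ Here $h_k\cap\sigma$ is the set of transverse crossings, one for each time at which $\sigma$, run through once, crosses $h_k$, and $(\theta_{h_k}^\sigma)_p\in(0,\pi)$ is the angle at $p$ from the direction of the oriented geodesic $h_k$ to the direction of (unoriented) $\sigma$ that points to the left of $h_k$. -/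

import Mathlib

open scoped Pointwise Matrix

namespace AffineTwist

/-! ### Lorentzian geometry of `ℝ₁²` and the hyperbolic plane -/

/-- The `(2+1)`-dimensional Lorentzian vector space. -/
abbrev V : Type := Fin 3 → ℝ

/-- The Lorentzian inner product `x₁y₁ + x₂y₂ - x₃y₃`. -/
def B (x y : V) : ℝ := x 0 * y 0 + x 1 * y 1 - x 2 * y 2

/-- `SO°(2,1)`: matrices of determinant one that preserve `B` and the future sheet of the
hyperboloid `B(x,x) = -1`. -/
def SO21 : Subgroup (Matrix.SpecialLinearGroup (Fin 3) ℝ) where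
  carrier := {A | (∀ x y : V, B (A.1 *ᵥ x) (A.1 *ᵥ y) = B x y) ∧
    ∀ x : V, B x x = -1 → 0 < x 2 → 0 < (A.1 *ᵥ x) 2}
  one_mem' := by
    refine ⟨fun x y => ?_, fun x _ h => ?_⟩
    · simp
    · simpa using h
  mul_mem' := by
    rintro a b ⟨ha, ha'⟩ ⟨hb, hb'⟩
    refine ⟨fun x y => ?_, fun x hx hx' => ?_⟩
    · simp only [Matrix.SpecialLinearGroup.coe_mul, ← Matrix.mulVec_mulVec, ha, hb]
    · simp only [Matrix.SpecialLinearGroup.coe_mul, ← Matrix.mulVec_mulVec]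
      exact ha' _ ((hb x x).trans hx) (hb' x hx hx')
  inv_mem' := by
    rintro a ⟨ha, ha'⟩
    have key : ∀ x : V, a.1 *ᵥ ((a⁻¹).1 *ᵥ x) = x := fun x => by
      rw [Matrix.mulVec_mulVec, ← Matrix.SpecialLinearGroup.coe_mul, mul_inv_cancel]
      simp
    have hB : ∀ x y : V, B ((a⁻¹).1 *ᵥ x) ((a⁻¹).1 *ᵥ y) = B x y := fun x y => by
      rw [← ha, key, key]
    refine ⟨hB, fun x hx hx' => ?_⟩
    by_contra hneg
    have h1 := (hB x x).trans hx
    rcases (not_lt.mp hneg).lt_or_eq with h | h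
    · have h2 := ha' (-((a⁻¹).1 *ᵥ x)) (by simpa [B] using h1) (by simpa using h)
      rw [Matrix.mulVec_neg, key, Pi.neg_apply] at h2
      linarith
    · simp only [B, h] at h1
      nlinarith [sq_nonneg (((a⁻¹).1 *ᵥ x) 0), sq_nonneg (((a⁻¹).1 *ᵥ x) 1)]

/-- The matrix of an element of `SO°(2,1)`. -/
def mat (h : SO21) : Matrix (Fin 3) (Fin 3) ℝ := h.1.1

/-- The hyperbolic plane: every future-pointing timelike ray is represented by its unique
point with `B(x,x) = -1`. -/
def Hyp : Type := {x : V // B x x = -1 ∧ 0 < x 2}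

instance : TopologicalSpace Hyp := instTopologicalSpaceSubtype

/-- The isometric action of `SO°(2,1)` on the hyperbolic plane. -/
instance : MulAction SO21 Hyp where
  smul h x := ⟨mat h *ᵥ x.1, (h.2.1 x.1 x.1).trans x.2.1, h.2.2 x.1 x.2.1 x.2.2⟩
  one_smul x := Subtype.ext (by
    change mat 1 *ᵥ x.1 = x.1
    simp [mat])
  mul_smul g h x := Subtype.ext (by
    change mat (g * h) *ᵥ x.1 = mat g *ᵥ (mat h *ᵥ x.1)
    simp [mat, Matrix.mulVec_mulVec])

/-- The hyperbolic distance, `cosh d(x,y) = -B(x,y)`. -/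
noncomputable def hypDist (x y : Hyp) : ℝ := Real.arcosh (-B x.1 y.1)

/-- The hyperbolic translation length `ℓ(h) = inf_x d(x, h x)`. -/
noncomputable def translationLength (h : SO21) : ℝ := ⨅ x : Hyp, hypDist x (h • x)

/-- The set of real eigenvalues of `h`. -/
def eigenvalues (h : SO21) : Set ℝ := {μ | ∃ v : V, v ≠ 0 ∧ mat h *ᵥ v = μ • v}

/-- An element is hyperbolic if it has three distinct real eigenvalues. -/
def IsHyperbolic (h : SO21) : Prop := (eigenvalues h).ncard = 3

/-- A future-pointing null vector of Euclidean norm one. -/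
def IsUnitFutureNull (v : V) : Prop :=
  B v v = 0 ∧ 0 < v 2 ∧ v 0 ^ 2 + v 1 ^ 2 + v 2 ^ 2 = 1

/-- `(X⁰, X⁻, X⁺)` is the null frame of the hyperbolic element `h`. -/
structure IsNullFrame (h : SO21) (X0 Xm Xp : V) : Prop where
  null_minus : IsUnitFutureNull Xm
  eigen_minus : ∃ μ, IsLeast (eigenvalues h) μ ∧ mat h *ᵥ Xm = μ • Xm
  null_plus : IsUnitFutureNull Xp
  eigen_plus : ∃ μ, IsGreatest (eigenvalues h) μ ∧ mat h *ᵥ Xp = μ • Xp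
  unit_zero : B X0 X0 = 1
  eigen_zero : mat h *ᵥ X0 = X0
  orientation : 0 < (Matrix.of ![X0, Xm, Xp]).det

/-- The null frame of a hyperbolic element (it exists and is unique for such elements). -/
noncomputable def nullFrame (h : SO21) : V × V × V :=
  Classical.epsilon fun F => IsNullFrame h F.1 F.2.1 F.2.2

/-- The unit spacelike vector `X⁰` of `h`. -/
noncomputable def X0 (h : SO21) : V := (nullFrame h).1

/-- The attracting null vector `X⁺` of `h`. -/
noncomputable def Xplus (h : SO21) : V := (nullFrame h).2.2

/-- The invariant axis of `h` in the hyperbolic plane, cut out by the plane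
`(X⁰)^⊥ = ⟨X⁻, X⁺⟩`. It is oriented from `X⁻` to `X⁺`. -/
def axis (h : SO21) : Set Hyp := {x | B x.1 (X0 h) = 0}

/-- The unit tangent vector at `y`, an element of the tangent space `y^⊥`, of the geodesic ray
from `y` to the ideal point spanned by the future null vector `ξ`. -/
noncomputable def unitTangent (y : Hyp) (ξ : V) : V := (-(B y.1 ξ)⁻¹) • ξ - y.1

/-- The angle at a common point `y` of the axes of `h₁` and `h₂`: the angle from the
direction of the oriented axis of `h₁` to that one of the two directions of the axis of `h₂` which
points to the left of `h₁`. (A tangent vector `w` at `y` points to the left of `v` when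
`(y, v, w)` is a positive frame of the ambient space.) -/
noncomputable def angle (h₁ h₂ : SO21) (y : Hyp) : ℝ :=
  let v := unitTangent y (Xplus h₁)
  let w := unitTangent y (Xplus h₂)
  Real.arccos (B v (if 0 < (Matrix.of ![y.1, v, w]).det then w else -w))

/-! ### The surface and its curves -/

/-- `G` is the Fuchsian group of a hyperbolic surface with at least one hole and without cusps. -/
structure IsHoledSurfaceGroup (G : Subgroup SO21) : Prop where
  discrete : DiscreteTopology G
  finitelyGenerated : G.FG
  hyperbolic : ∀ g ∈ G, g ≠ 1 → IsHyperbolic g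
  hole : ¬ CompactSpace (MulAction.orbitRel.Quotient G Hyp)

variable {G : Subgroup SO21}

/-- The surface `ℍ²/G`, with the quotient topology. -/
abbrev Surface (G : Subgroup SO21) : Type := MulAction.orbitRel.Quotient G Hyp

/-- The closed geodesic on the surface that `h` represents, as a set of points. -/
def curve (h : G) : Set (Surface G) := Quotient.mk _ '' axis (h : SO21)

/-- The closed geodesic represented by `h` is simple: `h` is neither trivial nor a proper power, and
two lifts of the geodesic are equal or disjoint. -/
structure IsSimple (h : G) : Prop where
  primitive : ∀ (k : G) (n : ℕ), k ^ n = h → n = 1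
  embedded : ∀ g : G, g • axis (h : SO21) = axis (h : SO21) ∨
    Disjoint (g • axis (h : SO21)) (axis (h : SO21))

/-- The closed geodesic represented by `h` separates the surface. -/
def IsSeparating (h : G) : Prop := ¬ IsPreconnected (curve h)ᶜ

/-- `x` lies on the same side as the axis of `h` of every other lift of the closed geodesic `h`. -/
def AdjacentToAxis (h : G) (x : Hyp) : Prop :=
  ∀ g : G, g • axis (h : SO21) ≠ axis (h : SO21) → ∀ a ∈ axis (h : SO21),
    0 < B (mat g *ᵥ X0 h) x.1 * B (mat g *ᵥ X0 h) a.1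

/-- Among the components of the complement of all lifts of `h` in the hyperbolic plane, the one
that borders the oriented axis of `h` on its left. -/
def leftRegion (h : G) : Set Hyp := {x | 0 < B (X0 h) x.1 ∧ AdjacentToAxis h x}

/-- The component of the complement of all lifts of `h` that borders the oriented axis of `h` on
its right. -/
def rightRegion (h : G) : Set Hyp := {x | B (X0 h) x.1 < 0 ∧ AdjacentToAxis h x}

/-- The fundamental group, as a subgroup of `G`, of the part of the surface to the left of `h`. -/
def leftGroup (h : G) : Subgroup G := MulAction.stabilizer G (leftRegion h)

/-- The fundamental group, as a subgroup of `G`, of the part of the surface to the right of `h`. -/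
def rightGroup (h : G) : Subgroup G := MulAction.stabilizer G (rightRegion h)

/-! ### Cocycles and deformations -/

/-- `u` is a cocycle on `G` with values in `ℝ₁²`. -/
def IsCocycle (u : G → V) : Prop := ∀ g₁ g₂ : G, u (g₁ * g₂) = mat g₁ *ᵥ u g₂ + u g₁

/-- `u` is the affine twist cocycle along `h`: zero on the group of one side, `X⁰ - g X⁰` on the
group of the other side, and determined elsewhere by the cocycle condition. -/
structure IsAffineTwist (h : G) (u : G → V) : Prop where
  cocycle : IsCocycle u
  right : ∀ g ∈ rightGroup h, u g = 0
  left : ∀ g ∈ leftGroup h, u g = X0 h - mat g *ᵥ X0 h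

/-- The identification of `ℝ₁²` with the Lie algebra `sl₂(ℝ)`. -/
def toSl2 (v : V) : Matrix (Fin 2) (Fin 2) ℝ := !![v 0, v 1 - v 2; v 1 + v 2, -v 0]

/-- The element of the Lie algebra of `SO°(2,1)` that corresponds to `v`: the adjoint action of
`toSl2 v`, transported to `ℝ₁²`. -/
def ad (v : V) : Matrix (Fin 3) (Fin 3) ℝ :=
  (2 : ℝ) • !![0, -v 2, v 1; v 2, 0, -v 0; v 1, -v 0, 0]

theorem toSl2_ad (v w : V) : toSl2 (ad v *ᵥ w) = toSl2 v * toSl2 w - toSl2 w * toSl2 v := by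
  ext i j
  fin_cases i <;> fin_cases j <;>
    simp [toSl2, ad, Matrix.mulVec, dotProduct, Fin.sum_univ_three] <;> ring

theorem trace_toSl2_mul (v w : V) : (toSl2 v * toSl2 w).trace = 2 * B v w := by
  simp [toSl2, B, Matrix.trace_fin_two]
  ring

/-- `ρ` is a deformation of the inclusion of `G` in `SO°(2,1)` through representations, and the
tangent vector at `t = 0` is given by the cocycle `u` under the identification of `ℝ₁²` with the Lie
algebra, that is, `ρ_t(g) = (1 + t u(g) + o(t)) g`. -/
structure IsDeformationAlong (u : G → V) (ρ : ℝ → G →* SO21) : Prop where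
  initial : ρ 0 = G.subtype
  tangent : ∀ (g : G) (i j : Fin 3),
    HasDerivAt (fun t => mat (ρ t g) i j) ((ad (u g) * mat g) i j) 0

/-! ### Intersections of closed geodesics -/

/-- A crossing, in the hyperbolic plane, of the axis of `σ` with a lift of the closed geodesic `h`.
The lift is the axis of a conjugate `h'` of `h`, and the crossing point is `y`. -/
structure Crossing (h σ : G) where
  lift : G
  point : Hyp
  isConj : IsConj h lift
  mem_lift : point ∈ axis (lift : SO21)
  mem_axis : point ∈ axis (σ : SO21)
  transverse : axis (lift : SO21) ≠ axis (σ : SO21)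

/-- Two crossings are identified when a power of `σ` takes one to the other. -/
def crossingSetoid (h σ : G) : Setoid (Crossing h σ) where
  r p q := ∃ n : ℤ, q.lift = σ ^ n * p.lift * (σ ^ n)⁻¹ ∧ q.point = σ ^ n • p.point
  iseqv :=
    { refl := fun p => ⟨0, by simp, by simp⟩
      symm := by
        rintro p q ⟨n, h1, h2⟩
        exact ⟨-n, by rw [h1]; group, by rw [h2, smul_smul, ← zpow_add]; simp⟩
      trans := by
        rintro p q r ⟨n, h1, h2⟩ ⟨m, h3, h4⟩
        exact ⟨m + n, by rw [h3, h1]; group, by rw [h4, h2, smul_smul, ← zpow_add]⟩ }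

/-- The transverse intersections `p ∈ h ∩ σ` of the closed geodesics `h` and `σ` on the surface, one
for every time at which `σ`, run through once, crosses `h`. -/
def Intersection (h σ : G) : Type := Quotient (crossingSetoid h σ)

/-- The angle at an intersection of the closed geodesics `h` and `σ`. It does not depend on the
representative, since `SO°(2,1)` preserves angles and the orientation. -/
noncomputable def Intersection.angle {h σ : G} (p : Intersection h σ) : ℝ :=
  AffineTwist.angle (Quotient.out p).lift σ (Quotient.out p).point

end AffineTwist

namespace AffineTwist

/-! ### The Lorentzian form and the Lorentzian cross product -/

/-! The length formula comes from the trace. A hyperbolic `g` with axis normal `n = X0 g` acts as a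
boost (`IsBoost`): it fixes `n`, and on the plane orthogonal to `n` it is `c + s · cr n`, where `c`
and `s` are the hyperbolic cosine and sine of the translation length. Hence tr `g` = 1 + 2`c`, while
tr(`ad u` · `g`) = 4`s` `B u n`. Dividing by the derivative of 2 cosh gives dℓ/dt = 2 `B (u σ) (X0
σ)` for a deformation along any cocycle `u` (`hasDerivAt_translationLength`). This is linear in `u`,
so each twist cocycle can be paired with `X0 σ` separately.

The twist cocycle has an explicit model, `g ↦ jump h o (g • o)`: the signed sum of the normals of
all lifts of `h` separating `o` from `g • o`, with `o` just to the right of the axis. Additivity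
along paths and equivariance make it a cocycle, and counting the lifts crossed gives the prescribed
values on the two side groups (`isAffineTwist_jump`). The sums are finite by proper discontinuity
(`finite_normals`). Uniqueness holds because the side groups generate `G`
(`leftGroup_sup_rightGroup`): a path is followed from region to region across the lifts, and
separation prevents a left region from being moved to a right one.

In the pairing with `X0 σ` the base point is irrelevant, since moving it adds a coboundary and `σ`
fixes `X0 σ`. With the base point `y` at a generic place on the axis of `σ`, the lifts separating
`y` from `σ • y` are exactly the crossings in one period (`exists_bijective_separating`). Each
contributes ±`B m (X0 σ)`: up to sign this is the inner product of the two unit tangents, and the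
sign of the crossing is the one that turns the direction of `σ` to the left of `h`. So every term is
the cosine of the angle (`cos_angle`, `B_jump_eq_finsum_cos`). -/

theorem B_comm (x y : V) : B x y = B y x := by simp only [B]; ring

theorem B_add_left (x y z : V) : B (x + y) z = B x z + B y z := by
  simp only [B, Pi.add_apply]; ring

theorem B_add_right (x y z : V) : B x (y + z) = B x y + B x z := by
  simp only [B, Pi.add_apply]; ring

theorem B_sub_left (x y z : V) : B (x - y) z = B x z - B y z := by
  simp only [B, Pi.sub_apply]; ring

theorem B_sub_right (x y z : V) : B x (y - z) = B x y - B x z := by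
  simp only [B, Pi.sub_apply]; ring

theorem B_smul_left (a : ℝ) (x y : V) : B (a • x) y = a * B x y := by
  simp only [B, Pi.smul_apply, smul_eq_mul]; ring

theorem B_smul_right (a : ℝ) (x y : V) : B x (a • y) = a * B x y := by
  simp only [B, Pi.smul_apply, smul_eq_mul]; ring

theorem B_neg_left (x y : V) : B (-x) y = -B x y := by
  simp only [B, Pi.neg_apply]; ring

theorem B_neg_right (x y : V) : B x (-y) = -B x y := by
  simp only [B, Pi.neg_apply]; ring

theorem B_zero_left (y : V) : B 0 y = 0 := by simp [B]

/-- The Lorentzian cross product; it is half the Lie bracket of `sl₂(ℝ)`. -/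
def cr (n x : V) : V := ![-n 2 * x 1 + n 1 * x 2, n 2 * x 0 - n 0 * x 2, n 1 * x 0 - n 0 * x 1]

theorem ad_mulVec (n x : V) : ad n *ᵥ x = (2 : ℝ) • cr n x := by
  ext i
  fin_cases i <;> simp [ad, cr, Matrix.mulVec, dotProduct, Fin.sum_univ_three] <;> ring

theorem cr_add_right (n x y : V) : cr n (x + y) = cr n x + cr n y := by
  ext i
  fin_cases i <;> simp [cr] <;> ring

theorem cr_sub_right (n x y : V) : cr n (x - y) = cr n x - cr n y := by
  ext i
  fin_cases i <;> simp [cr] <;> ring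

theorem cr_smul_right (a : ℝ) (n x : V) : cr n (a • x) = a • cr n x := by
  ext i
  fin_cases i <;> simp [cr] <;> ring

theorem cr_smul_left (a : ℝ) (n x : V) : cr (a • n) x = a • cr n x := by
  ext i
  fin_cases i <;> simp [cr] <;> ring

theorem cr_neg_left (n x : V) : cr (-n) x = -cr n x := by
  ext i
  fin_cases i <;> simp [cr] <;> ring

theorem cr_comm (n x : V) : cr n x = -cr x n := by
  ext i
  fin_cases i <;> simp [cr] <;> ring

theorem cr_self (n : V) : cr n n = 0 := by
  ext i
  fin_cases i <;> simp [cr] <;> ring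

theorem cr_cr (a b x : V) : cr a (cr b x) = B a b • x - B a x • b := by
  ext i
  fin_cases i <;> simp [cr, B] <;> ring

theorem B_cr_left (n x y : V) : B (cr n x) y = -B x (cr n y) := by
  simp [cr, B]; ring

theorem B_cr_self_right (n x : V) : B x (cr n x) = 0 := by
  simp [cr, B]; ring

theorem B_cr_self_left (n x : V) : B n (cr n x) = 0 := by
  simp [cr, B]; ring

theorem det_of_eq (a b c : V) : (Matrix.of ![a, b, c]).det = B (cr a b) c := by
  simp [Matrix.det_fin_three, cr, B]; ring

theorem eq_of_B_left {x y : V} (h : ∀ z, B x z = B y z) : x = y := by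
  ext i
  fin_cases i
  · simpa [B] using h ![1, 0, 0]
  · simpa [B] using h ![0, 1, 0]
  · simpa [B] using h ![0, 0, 1]

/-! ### The action of the group on the cross product -/

theorem B_mat (g : SO21) (x y : V) : B (mat g *ᵥ x) (mat g *ᵥ y) = B x y := g.2.1 x y

theorem mat_mul (g h : SO21) : mat (g * h) = mat g * mat h := by simp [mat]

theorem mat_one : mat 1 = 1 := by simp [mat]

theorem mat_mulVec_mul (g h : SO21) (x : V) : mat (g * h) *ᵥ x = mat g *ᵥ (mat h *ᵥ x) := by
  rw [mat_mul, Matrix.mulVec_mulVec]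

theorem mat_one_mulVec (x : V) : mat 1 *ᵥ x = x := by rw [mat_one, Matrix.one_mulVec]

theorem mat_inv_mulVec (g : SO21) (x : V) : mat g⁻¹ *ᵥ (mat g *ᵥ x) = x := by
  rw [← mat_mulVec_mul, inv_mul_cancel, mat_one_mulVec]

theorem mat_mulVec_inv (g : SO21) (x : V) : mat g *ᵥ (mat g⁻¹ *ᵥ x) = x := by
  rw [← mat_mulVec_mul, mul_inv_cancel, mat_one_mulVec]

theorem B_mat_left (g : SO21) (x y : V) : B (mat g *ᵥ x) y = B x (mat g⁻¹ *ᵥ y) := by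
  conv_lhs => rw [← mat_mulVec_inv g y]
  exact B_mat _ _ _

theorem det_mat (g : SO21) : (mat g).det = 1 := g.1.2

theorem mat_ext {g h : SO21} (H : ∀ x, mat g *ᵥ x = mat h *ᵥ x) : g = h := by
  apply Subtype.ext
  apply Subtype.ext
  exact Matrix.ext_of_mulVec_single fun i => H _

theorem det_of_mulVec (g : SO21) (a b c : V) :
    (Matrix.of ![mat g *ᵥ a, mat g *ᵥ b, mat g *ᵥ c]).det = (Matrix.of ![a, b, c]).det := by
  have : Matrix.of ![mat g *ᵥ a, mat g *ᵥ b, mat g *ᵥ c] = Matrix.of ![a, b, c] * (mat g)ᵀ := by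
    ext i j
    fin_cases i <;> simp [Matrix.mul_apply, Matrix.mulVec, dotProduct, Fin.sum_univ_three] <;> ring
  rw [this, Matrix.det_mul, Matrix.det_transpose, det_mat, mul_one]

/-- The cross product is dual to the determinant through `B`, and the group preserves both. -/
theorem mat_cr (g : SO21) (n x : V) : mat g *ᵥ cr n x = cr (mat g *ᵥ n) (mat g *ᵥ x) := by
  apply eq_of_B_left
  intro z
  rw [← mat_mulVec_inv g z, B_mat, ← det_of_eq, ← det_of_eq, det_of_mulVec]

/-! ### Timelike and null vectors -/

/-- Cauchy–Schwarz in the first two coordinates, which are dominated by the time coordinate. -/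
theorem B_lt_zero_of_future {x y : V} (hx : B x x < 0) (hx' : 0 < x 2) (hy : B y y ≤ 0)
    (hy' : 0 < y 2) : B x y < 0 := by
  simp only [B] at *
  have h1 : (x 0 * y 0 + x 1 * y 1) ^ 2 ≤ (x 0 ^ 2 + x 1 ^ 2) * (y 0 ^ 2 + y 1 ^ 2) := by
    nlinarith [sq_nonneg (x 0 * y 1 - x 1 * y 0)]
  have h2 : (x 0 ^ 2 + x 1 ^ 2) * (y 0 ^ 2 + y 1 ^ 2) ≤ (x 0 ^ 2 + x 1 ^ 2) * (y 2) ^ 2 :=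
    mul_le_mul_of_nonneg_left (by nlinarith) (by positivity)
  have h3 : (x 0 ^ 2 + x 1 ^ 2) * (y 2) ^ 2 < (x 2) ^ 2 * (y 2) ^ 2 :=
    mul_lt_mul_of_pos_right (by nlinarith) (by positivity)
  have h4 : (x 0 * y 0 + x 1 * y 1) ^ 2 < (x 2 * y 2) ^ 2 := by nlinarith
  have := abs_lt_of_sq_lt_sq h4 (by positivity)
  linarith [le_abs_self (x 0 * y 0 + x 1 * y 1)]

theorem B_le_zero_of_null {x y : V} (hx : B x x = 0) (hx' : 0 < x 2) (hy : B y y = 0)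
    (hy' : 0 < y 2) : B x y ≤ 0 := by
  simp only [B] at *
  have h1 : (x 0 * y 0 + x 1 * y 1) ^ 2 ≤ (x 0 ^ 2 + x 1 ^ 2) * (y 0 ^ 2 + y 1 ^ 2) := by
    nlinarith [sq_nonneg (x 0 * y 1 - x 1 * y 0)]
  have h2 : (x 0 ^ 2 + x 1 ^ 2) * (y 0 ^ 2 + y 1 ^ 2) = (x 2 * y 2) ^ 2 := by
    rw [show x 0 ^ 2 + x 1 ^ 2 = x 2 ^ 2 by linarith, show y 0 ^ 2 + y 1 ^ 2 = y 2 ^ 2 by linarith]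
    ring
  have := abs_le_of_sq_le_sq (h1.trans h2.le) (by positivity)
  linarith [le_abs_self (x 0 * y 0 + x 1 * y 1)]

/-- A causal vector in the future half space of a future timelike vector is future. -/
theorem future_of_B_lt_zero {x y : V} (hx : B x x < 0) (hx' : 0 < x 2) (hy : B y y ≤ 0)
    (h : B x y < 0) : 0 < y 2 := by
  by_contra hneg
  rcases (not_lt.mp hneg).lt_or_eq with h' | h'
  · have := B_lt_zero_of_future hx hx' (y := -y) (by rw [B_neg_left, B_neg_right]; linarith)
      (by simpa using h')
    rw [B_neg_right] at this
    linarith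
  · have h0 : y 0 = 0 := by simp only [B, h'] at hy; nlinarith [sq_nonneg (y 0), sq_nonneg (y 1)]
    have h1 : y 1 = 0 := by simp only [B, h'] at hy; nlinarith [sq_nonneg (y 0), sq_nonneg (y 1)]
    simp [B, h0, h1, h'] at h

/-- Orthogonal future null vectors are proportional. -/
theorem null_proportional {x y : V} (hx : B x x = 0) (hy : B y y = 0) (hxy : B x y = 0) :
    y 2 • x = x 2 • y := by
  -- This combination is null and has last coordinate zero, so its Euclidean norm vanishes.
  have hz : B (y 2 • x - x 2 • y) (y 2 • x - x 2 • y) = 0 := by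
    simp only [B_sub_left, B_sub_right, B_smul_left, B_smul_right, hx, hy, hxy, B_comm y x]
    ring
  have h2 : (y 2 • x - x 2 • y) 2 = 0 := by simp; ring
  rw [← sub_eq_zero]
  set z := y 2 • x - x 2 • y
  simp only [B, h2] at hz
  ext i
  fin_cases i
  · change z 0 = 0
    nlinarith [sq_nonneg (z 0), sq_nonneg (z 1)]
  · change z 1 = 0
    nlinarith [sq_nonneg (z 0), sq_nonneg (z 1)]
  · exact h2

theorem Hyp.B_self (x : Hyp) : B x.1 x.1 = -1 := x.2.1

theorem Hyp.pos (x : Hyp) : 0 < x.1 2 := x.2.2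

theorem Hyp.smul_val (g : SO21) (x : Hyp) : (g • x).1 = mat g *ᵥ x.1 := rfl

/-- Reversed Cauchy–Schwarz. By Lagrange's identity `B x y ^ 2 - 1` is the Lorentzian square of the
cross product; that vector is orthogonal to the timelike `x`, so its square is nonnegative. -/
theorem Hyp.one_le_neg_B (x y : Hyp) : 1 ≤ -B x.1 y.1 := by
  have h := B_lt_zero_of_future (by linarith [x.B_self]) x.pos (by linarith [y.B_self]) y.pos
  have hx := x.B_self
  have hy := y.B_self
  have hx' := x.pos
  have hy' := y.pos
  simp only [B] at *
  have h1 : 1 ≤ (x.1 0 * y.1 0 + x.1 1 * y.1 1 - x.1 2 * y.1 2) ^ 2 := by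
    have e0 : 1 ≤ (x.1 2 * y.1 2 - (x.1 0 * y.1 0 + x.1 1 * y.1 1)) ^ 2 -
      ((x.1 2 * y.1 0 - x.1 0 * y.1 2) ^ 2 + (x.1 2 * y.1 1 - x.1 1 * y.1 2) ^ 2 -
        (x.1 0 * y.1 1 - x.1 1 * y.1 0) ^ 2) := by
      have : (x.1 0 * x.1 0 + x.1 1 * x.1 1 - x.1 2 * x.1 2) *
        (y.1 0 * y.1 0 + y.1 1 * y.1 1 - y.1 2 * y.1 2) = 1 := by rw [hx, hy]; norm_num
      linarith
    have e1 : (x.1 0 * y.1 1 - x.1 1 * y.1 0) ^ 2 ≤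
        (x.1 2 * y.1 0 - x.1 0 * y.1 2) ^ 2 + (x.1 2 * y.1 1 - x.1 1 * y.1 2) ^ 2 := by
      have e2 : (x.1 2 * (x.1 0 * y.1 1 - x.1 1 * y.1 0)) ^ 2 ≤ (x.1 0 ^ 2 + x.1 1 ^ 2) *
          ((x.1 2 * y.1 0 - x.1 0 * y.1 2) ^ 2 + (x.1 2 * y.1 1 - x.1 1 * y.1 2) ^ 2) := by
        nlinarith [sq_nonneg (x.1 0 * (x.1 2 * y.1 0 - x.1 0 * y.1 2) +
          x.1 1 * (x.1 2 * y.1 1 - x.1 1 * y.1 2))]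
      have e3 : x.1 0 ^ 2 + x.1 1 ^ 2 ≤ x.1 2 ^ 2 := by nlinarith
      have e4 := e2.trans (mul_le_mul_of_nonneg_right e3 (by positivity))
      rw [mul_pow] at e4
      exact le_of_mul_le_mul_left e4 (by positivity)
    linarith
  nlinarith

theorem Hyp.one_le_two (x : Hyp) : 1 ≤ x.1 2 := by
  have h := x.B_self
  have h' := x.pos
  simp only [B] at h
  nlinarith [sq_nonneg (x.1 0), sq_nonneg (x.1 1)]

/-- Every geodesic contains a point. -/
theorem exists_hyp_orthogonal {n : V} (hn : 0 < B n n) : ∃ y : Hyp, B n y.1 = 0 := by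
  set r := n 0 ^ 2 + n 1 ^ 2 with hr
  have hr0 : 0 < r := by simp only [B] at hn; nlinarith [sq_nonneg (n 2)]
  set q := r * B n n with hq
  have hq0 : 0 < q := by positivity
  have hs : √q ^ 2 = q := Real.sq_sqrt hq0.le
  have hs0 : 0 < √q := Real.sqrt_pos.mpr hq0
  -- The vector (`n 2 * n 0`, `n 2 * n 1`, `r`) is orthogonal to `n` and has square `-q`.
  refine ⟨⟨(√q)⁻¹ • ![n 2 * n 0, n 2 * n 1, r], ?_, ?_⟩, ?_⟩
  · rw [B_smul_left, B_smul_right]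
    have : B ![n 2 * n 0, n 2 * n 1, r] ![n 2 * n 0, n 2 * n 1, r] = -(√q ^ 2) := by
      rw [hs, hq, hr]; simp [B]; ring
    rw [this]
    field_simp
  · simp; positivity
  · change B n ((√q)⁻¹ • ![n 2 * n 0, n 2 * n 1, r]) = 0
    rw [B_smul_right]
    simp [B, hr]; right; ring

/-- The only vectors orthogonal to a geodesic are the multiples of its unit normal. -/
theorem eq_smul_of_orthogonal {n m y : V} (hn : B n n = 1) (hy : B y y = -1) (hny : B n y = 0)
    (hmy : B m y = 0) (hmv : B m (cr n y) = 0) : m = B m n • n := by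
  have hv : B (cr n y) (cr n y) = 1 := by
    rw [B_cr_left, cr_cr, hn, hny]; simp [hy]
  -- Both `cr y m` and `cr n y` are orthogonal to `y` and to `m`, hence parallel; applying `cr y`
  -- once more turns them into multiples of `m` and `n`.
  have hp1 : cr (cr n y) (cr y m) = 0 := by
    rw [cr_cr, B_comm (cr n y) m, hmv, B_comm, B_cr_self_right]; simp
  have hp2 : cr y m = B (cr n y) (cr y m) • cr n y := by
    have := cr_cr (cr n y) (cr n y) (cr y m)
    rw [hp1, hv, one_smul] at this
    have h0 : cr (cr n y) 0 = 0 := by ext i; fin_cases i <;> simp [cr]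
    rw [h0] at this
    exact (sub_eq_zero.mp this.symm)
  have h1 : cr y (cr y m) = -m := by rw [cr_cr, hy, B_comm, hmy]; simp
  have h2 : cr y (cr n y) = n := by
    rw [cr_comm n y]
    have : cr y (-cr y n) = -cr y (cr y n) := by
      rw [← neg_one_smul ℝ (cr y n), cr_smul_right]; simp
    rw [this, cr_cr, hy, B_comm, hny]; simp
  have h3 : m = (-B (cr n y) (cr y m)) • n := by
    have : cr y (cr y m) = B (cr n y) (cr y m) • cr y (cr n y) := by
      rw [← cr_smul_right, ← hp2]
    rw [h1, h2] at this
    rw [neg_smul, ← this, neg_neg]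
  have h4 : B m n = -B (cr n y) (cr y m) := by
    conv_lhs => rw [h3]
    rw [B_smul_left, hn, mul_one]
  rw [h4]
  exact h3

/-! ### Hyperbolic elements as boosts -/

/-- `g` is the hyperbolic translation along the geodesic with unit normal `n` by a distance with
hyperbolic cosine `c` and hyperbolic sine `s`. -/
structure IsBoost (g : SO21) (n : V) (c s : ℝ) : Prop where
  unit : B n n = 1
  one_lt : 1 < c
  pos : 0 < s
  sq_sub_sq : c ^ 2 - s ^ 2 = 1
  apply : ∀ x, mat g *ᵥ x = c • x - ((c - 1) * B n x) • n + s • cr n x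

theorem adjugate_mat (g : SO21) : (mat g).adjugate = mat g⁻¹ := by
  have h1 : mat g⁻¹ * mat g = 1 := by rw [← mat_mul, inv_mul_cancel, mat_one]
  have h2 : mat g * (mat g).adjugate = 1 := by rw [Matrix.mul_adjugate, det_mat, one_smul]
  exact (left_inv_eq_right_inv h1 h2).symm

/-- The inverse is the adjoint for the form with Gram matrix diag(1, 1, -1). -/
theorem mat_inv_eq (g : SO21) : mat g⁻¹ =
    Matrix.diagonal ![1, 1, -1] * (mat g)ᵀ * Matrix.diagonal ![1, 1, -1] := by
  have h : ∀ i j, B (Pi.single i 1) (mat g⁻¹ *ᵥ Pi.single j 1) =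
      B (mat g *ᵥ Pi.single i 1) (Pi.single j 1) := fun i j => (B_mat_left g _ _).symm
  ext i j
  have := h i j
  fin_cases i <;> fin_cases j <;>
    simp [B] at this <;> simp [Matrix.mul_apply, Matrix.diagonal_apply] <;> linarith

theorem trace_inv (g : SO21) : (mat g⁻¹).trace = (mat g).trace := by
  rw [mat_inv_eq]
  simp [Matrix.trace_fin_three, Matrix.mul_apply, Matrix.diagonal_apply]

theorem adjugate_eq_sq_sub (M : Matrix (Fin 3) (Fin 3) ℝ) :
    M.adjugate = M * M - M.trace • M + M.adjugate.trace • 1 := by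
  ext i j
  fin_cases i <;> fin_cases j <;>
    simp [Matrix.adjugate_fin_three, Matrix.mul_apply, Matrix.trace_fin_three,
      Fin.sum_univ_three] <;> ring

/-- Cayley–Hamilton divided by `g`: since `g` and its inverse have equal trace, both middle
coefficients of the characteristic polynomial are given by that trace. -/
theorem mat_sq (g : SO21) :
    mat g * mat g = (mat g).trace • mat g - (mat g).trace • 1 + mat g⁻¹ := by
  have h := adjugate_eq_sq_sub (mat g)
  rw [adjugate_mat, trace_inv] at h
  rw [h]
  abel

/-- The vector corresponding to the antisymmetric part of `g`. -/
noncomputable def antisymmPart (g : SO21) : V :=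
  ![-(mat g 1 2 + mat g 2 1) / 2, (mat g 0 2 + mat g 2 0) / 2, (mat g 1 0 - mat g 0 1) / 2]

theorem ad_antisymmPart (g : SO21) : ad (antisymmPart g) = mat g - mat g⁻¹ := by
  rw [mat_inv_eq]
  ext i j
  fin_cases i <;> fin_cases j <;>
    simp [ad, antisymmPart, Matrix.mul_apply, Matrix.diagonal_apply] <;> ring

theorem ad_antisymmPart_sq (g : SO21) : ad (antisymmPart g) * ad (antisymmPart g) =
    ((mat g).trace + 1) • (mat g + mat g⁻¹) - (2 * (mat g).trace + 2) • 1 := by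
  have h1 : mat g⁻¹ * mat g = 1 := by rw [← mat_mul, inv_mul_cancel, mat_one]
  have h2 : mat g * mat g⁻¹ = 1 := by rw [← mat_mul, mul_inv_cancel, mat_one]
  have h3 := mat_sq g
  have h4 := mat_sq g⁻¹
  rw [trace_inv, inv_inv] at h4
  rw [ad_antisymmPart, sub_mul, mul_sub, mul_sub, h1, h2, h3, h4]
  module

theorem trace_ad_mul_ad (v w : V) : (ad v * ad w).trace = 8 * B v w := by
  simp [Matrix.trace_fin_three, ad, B]
  ring

theorem B_antisymmPart (g : SO21) : 4 * B (antisymmPart g) (antisymmPart g) =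
    ((mat g).trace - 3) * ((mat g).trace + 1) := by
  have h := congrArg Matrix.trace (ad_antisymmPart_sq g)
  rw [trace_ad_mul_ad, Matrix.trace_sub, Matrix.trace_smul, Matrix.trace_smul, Matrix.trace_add,
    trace_inv, Matrix.trace_one] at h
  simp only [smul_eq_mul, Fintype.card_fin] at h
  push_cast at h
  linarith

/-- The difference `g - g⁻¹` and, up to the factor trace + 1, the sum `g + g⁻¹` are expressed by the
antisymmetric part, so `g` can be recovered from it. The factor stays on both sides because it may
vanish. -/
theorem mat_mulVec_eq (g : SO21) (x : V) :
    ((mat g).trace + 1) • (mat g *ᵥ x) = ((mat g).trace + 1) • x +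
      ((mat g).trace + 1) • cr (antisymmPart g) x + (2 : ℝ) •
      (B (antisymmPart g) (antisymmPart g) • x - B (antisymmPart g) x • antisymmPart g) := by
  have h1 := congrArg (· *ᵥ x) (ad_antisymmPart g)
  have h2 := congrArg (· *ᵥ x) (ad_antisymmPart_sq g)
  simp only [← Matrix.mulVec_mulVec, ad_mulVec, Matrix.sub_mulVec, Matrix.smul_mulVec,
    Matrix.add_mulVec, Matrix.one_mulVec] at h1 h2
  rw [cr_smul_right, cr_cr] at h2
  have h3 : mat g⁻¹ *ᵥ x = mat g *ᵥ x - (2 : ℝ) • cr (antisymmPart g) x := by rw [h1]; abel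
  rw [h3] at h2
  set t := (mat g).trace
  set w := antisymmPart g
  have h4 : (2 : ℝ) • ((t + 1) • (mat g *ᵥ x)) = (2 : ℝ) • ((t + 1) • x +
      (t + 1) • cr w x + (2 : ℝ) • (B w w • x - B w x • w)) := by
    linear_combination (norm := module) -h2
  exact smul_right_injective V (two_ne_zero (α := ℝ)) h4

/-- The antisymmetric part has square (t - 3)(t + 1)/4 = ((t - 1)/2)² - 1 for the trace t, which is
positive here; normalizing it gives the axis normal. -/
theorem exists_isBoost_of_trace {g : SO21} (h : 3 < (mat g).trace) : ∃ n,
    IsBoost g n (((mat g).trace - 1) / 2) (√((((mat g).trace - 1) / 2) ^ 2 - 1)) := by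
  set t := (mat g).trace with ht
  set w := antisymmPart g with hw
  set s := √(((t - 1) / 2) ^ 2 - 1) with hs
  have hB := B_antisymmPart g
  rw [← ht, ← hw] at hB
  have hpos : 0 < ((t - 1) / 2) ^ 2 - 1 := by nlinarith
  have hs0 : 0 < s := Real.sqrt_pos.mpr hpos
  have hs2 : s ^ 2 = ((t - 1) / 2) ^ 2 - 1 := Real.sq_sqrt hpos.le
  have hBs : B w w = s ^ 2 := by rw [hs2]; linarith
  refine ⟨s⁻¹ • w, ?_, by linarith, hs0, by linarith, fun x => ?_⟩
  · rw [B_smul_left, B_smul_right, hBs]; field_simp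
  · have h1 := mat_mulVec_eq g x
    rw [← ht, ← hw, hBs] at h1
    have ht1 : t + 1 ≠ 0 := by linarith
    apply smul_right_injective V ht1
    simp only
    rw [h1, cr_smul_left, B_smul_left, smul_smul s, mul_inv_cancel₀ hs0.ne', one_smul, smul_smul,
      show ((t - 1) / 2 - 1) * (s⁻¹ * B w x) * s⁻¹ = (2 / (t + 1)) * B w x by
        field_simp; rw [hs2]; ring]
    have e1 : (2 : ℝ) * s ^ 2 = (t + 1) * ((t - 1) / 2 - 1) := by rw [hs2]; ring
    rw [smul_sub, smul_smul, e1, smul_add, smul_sub, smul_smul (t + 1),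
      smul_smul (t + 1), show (t + 1) * (2 / (t + 1) * B w x) = 2 * B w x by field_simp]
    module

theorem eigenvalue_root {g : SO21} {μ : ℝ} (h : μ ∈ eigenvalues g) :
    (μ - 1) * (μ ^ 2 - ((mat g).trace - 1) * μ + 1) = 0 := by
  obtain ⟨v, hv, hμ⟩ := h
  set t := (mat g).trace
  have h1 : mat g * (mat g * mat g) = mat g * (t • mat g - t • 1 + mat g⁻¹) := by rw [mat_sq]
  rw [mul_add, mul_sub, ← mat_mul g g⁻¹, mul_inv_cancel, mat_one] at h1
  have h2 := congrArg (· *ᵥ v) h1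
  simp only [Matrix.add_mulVec, Matrix.sub_mulVec, Matrix.mul_smul, Matrix.smul_mulVec,
    ← Matrix.mulVec_mulVec, hμ, Matrix.mulVec_smul, Matrix.one_mulVec, mul_one] at h2
  have h3 : ((μ - 1) * (μ ^ 2 - (t - 1) * μ + 1)) • v = 0 := by
    linear_combination (norm := module) h2
  exact (smul_eq_zero.mp h3).resolve_right hv

theorem IsHyperbolic.three_lt_trace {g : SO21} (h : IsHyperbolic g) : 3 < (mat g).trace := by
  set t := (mat g).trace with ht
  by_contra hle
  rw [not_lt] at hle
  rcases lt_or_ge t (-1) with h1 | h1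
  -- For trace below -1 the antisymmetric part is spacelike, and a point `y` of its geodesic would
  -- satisfy `B y (g y)` = (1 - t)/2 > 0, impossible for two points of the hyperbolic plane.
  · have hB := B_antisymmPart g
    rw [← ht] at hB
    obtain ⟨y, hy⟩ := exists_hyp_orthogonal (n := antisymmPart g) (by nlinarith)
    have h2 := mat_mulVec_eq g y.1
    rw [← ht, hy] at h2
    have h3 := congrArg (B y.1) h2
    simp only [B_smul_right, B_add_right, B_sub_right, B_cr_self_right, y.B_self] at h3
    have h4 := Hyp.one_le_neg_B y (g • y)
    rw [Hyp.smul_val] at h4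
    nlinarith
  -- For trace in [-1, 3] the quadratic factor has nonpositive discriminant, so a real root can only
  -- be the double one and at most two eigenvalues remain.
  · have hsub : eigenvalues g ⊆ {1, (t - 1) / 2} := by
      intro μ hμ
      rcases mul_eq_zero.mp (eigenvalue_root hμ) with h2 | h2
      · left; linarith
      · right
        rw [← ht] at h2
        have : (μ - (t - 1) / 2) ^ 2 = 0 := by
          apply le_antisymm _ (sq_nonneg _)
          nlinarith
        exact sub_eq_zero.mp (pow_eq_zero_iff two_ne_zero |>.mp this)
    have h2 := Set.ncard_le_ncard hsub (by simp)
    have h3 := Set.ncard_insert_le (1 : ℝ) {(t - 1) / 2}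
    rw [Set.ncard_singleton] at h3
    rw [IsHyperbolic] at h
    omega

namespace IsBoost

variable {g : SO21} {n : V} {c s : ℝ}

theorem fixed (h : IsBoost g n c s) : mat g *ᵥ n = n := by
  rw [h.apply, h.unit, cr_self]
  module

theorem B_normal (h : IsBoost g n c s) (x : V) : B n (mat g *ᵥ x) = B n x := by
  conv_lhs => rw [← h.fixed]
  exact B_mat _ _ _

theorem apply_orthogonal (h : IsBoost g n c s) {x : V} (hx : B n x = 0) :
    mat g *ᵥ x = c • x + s • cr n x := by
  rw [h.apply, hx]
  module

theorem cr_cr_orthogonal (h : IsBoost g n c s) {x : V} (hx : B n x = 0) :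
    cr n (cr n x) = x := by
  rw [cr_cr, h.unit, hx]
  module

theorem conj (h : IsBoost g n c s) (k : SO21) : IsBoost (k * g * k⁻¹) (mat k *ᵥ n) c s := by
  refine ⟨by rw [B_mat, h.unit], h.one_lt, h.pos, h.sq_sub_sq, fun x => ?_⟩
  rw [mat_mulVec_mul, mat_mulVec_mul, h.apply, Matrix.mulVec_add, Matrix.mulVec_sub,
    Matrix.mulVec_smul, Matrix.mulVec_smul, Matrix.mulVec_smul, mat_cr, mat_mulVec_inv, B_mat_left]

theorem ext {g' : SO21} (h : IsBoost g n c s) (h' : IsBoost g' n c s) : g = g' :=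
  mat_ext fun x => by rw [h.apply, h'.apply]

theorem trace_eq (h : IsBoost g n c s) : (mat g).trace = 1 + 2 * c := by
  have h0 := congrFun (h.apply (Pi.single 0 1)) 0
  have h1 := congrFun (h.apply (Pi.single 1 1)) 1
  have h2 := congrFun (h.apply (Pi.single 2 1)) 2
  have hu := h.unit
  simp [B, cr] at h0 h1 h2 hu
  rw [Matrix.trace_fin_three, h0, h1, h2]
  linear_combination (1 - c) * hu

/-- First variation of the trace: it sees only the component of `u` along the axis normal. -/
theorem trace_ad_mul (h : IsBoost g n c s) (u : V) : (ad u * mat g).trace = 4 * s * B u n := by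
  have h0 : ∀ i j, mat g i j = (mat g *ᵥ Pi.single j 1) i := fun i j => by simp
  have h1 : ∀ i j, mat g i j = (c • (Pi.single j 1 : V) -
      ((c - 1) * B n (Pi.single j 1)) • n + s • cr n (Pi.single j 1)) i :=
    fun i j => by rw [h0, h.apply]
  rw [Matrix.trace_fin_three]
  simp only [Matrix.mul_apply, Fin.sum_univ_three, h1]
  simp [ad, B, cr]
  ring

theorem neg_B_apply (h : IsBoost g n c s) (x : Hyp) :
    -B x.1 (g • x).1 = c + (c - 1) * B n x.1 ^ 2 := by
  rw [Hyp.smul_val, h.apply]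
  simp only [B_add_right, B_sub_right, B_smul_right, B_cr_self_right, x.B_self, B_comm x.1 n]
  ring

/-- By `neg_B_apply` the displacement has hyperbolic cosine `c + (c - 1) * B n x ^ 2`, which is
smallest exactly on the axis. -/
theorem translationLength_eq (h : IsBoost g n c s) : translationLength g = Real.arcosh c := by
  have hc := h.one_lt
  obtain ⟨y, hy⟩ := exists_hyp_orthogonal (n := n) (by rw [h.unit]; norm_num)
  have : Nonempty Hyp := ⟨y⟩
  have hle : ∀ x : Hyp, Real.arcosh c ≤ hypDist x (g • x) := fun x => by
    rw [hypDist, h.neg_B_apply]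
    have := mul_nonneg (by linarith : 0 ≤ c - 1) (sq_nonneg (B n x.1))
    exact (Real.arcosh_le_arcosh (by linarith) (by linarith)).mpr (by linarith)
  apply le_antisymm
  · have hb : BddBelow (Set.range fun x : Hyp => hypDist x (g • x)) := ⟨_, by
      rintro _ ⟨x, rfl⟩; exact hle x⟩
    refine (ciInf_le hb y).trans ?_
    rw [hypDist, h.neg_B_apply, hy]
    simp
  · exact le_ciInf hle

/-- An eigenvector not orthogonal to `n` has eigenvalue 1. On the orthogonal plane `cr n` is an
involution, so its eigenvalues ±1 give `c ± s`. -/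
theorem eigenvalue_cases (h : IsBoost g n c s) {μ : ℝ} {x : V} (hx : x ≠ 0)
    (hμ : mat g *ᵥ x = μ • x) : μ = 1 ∨ B n x = 0 ∧ cr n x = x ∧ μ = c + s ∨
      B n x = 0 ∧ cr n x = -x ∧ μ = c - s := by
  have hs := h.pos
  by_cases hn : B n x = 0
  · right
    have h1 : cr n x = ((μ - c) / s) • x := by
      have := h.apply_orthogonal hn
      rw [hμ] at this
      apply smul_right_injective V hs.ne'
      simp only
      rw [smul_smul, mul_div_cancel₀ _ hs.ne', sub_smul, this]
      abel
    have h2 := h.cr_cr_orthogonal hn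
    rw [h1, cr_smul_right, h1, smul_smul] at h2
    have h3 : ((μ - c) / s * ((μ - c) / s) - 1) • x = 0 := by rw [sub_smul, h2]; simp
    have h4 := (smul_eq_zero.mp h3).resolve_right hx
    have h5 : ((μ - c) / s - 1) * ((μ - c) / s + 1) = 0 := by linarith
    rcases mul_eq_zero.mp h5 with h6 | h6
    · left
      have h7 : (μ - c) / s = 1 := by linarith
      refine ⟨hn, by rw [h1, h7, one_smul], ?_⟩
      rw [div_eq_iff hs.ne'] at h7
      linarith
    · right
      have h7 : (μ - c) / s = -1 := by linarith
      refine ⟨hn, by rw [h1, h7, neg_one_smul], ?_⟩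
      rw [div_eq_iff hs.ne'] at h7
      linarith
  · left
    have := h.B_normal x
    rw [hμ, B_smul_right] at this
    exact mul_right_cancel₀ hn (by rw [this, one_mul])

theorem sub_lt_one (h : IsBoost g n c s) : c - s < 1 := by
  nlinarith [h.one_lt, h.pos, h.sq_sub_sq]

theorem one_lt_add (h : IsBoost g n c s) : 1 < c + s := by
  linarith [h.one_lt, h.pos]

theorem isLeast (h : IsBoost g n c s) {x : V} (hx : x ≠ 0) (hn : B n x = 0) (hc : cr n x = -x) :
    IsLeast (eigenvalues g) (c - s) := by
  refine ⟨⟨x, hx, by rw [h.apply_orthogonal hn, hc]; module⟩, ?_⟩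
  rintro μ ⟨v, hv, hμ⟩
  have h1 := h.sub_lt_one
  have h2 := h.pos
  rcases h.eigenvalue_cases hv hμ with h | h | h <;> linarith

theorem isGreatest (h : IsBoost g n c s) {x : V} (hx : x ≠ 0) (hn : B n x = 0) (hc : cr n x = x) :
    IsGreatest (eigenvalues g) (c + s) := by
  refine ⟨⟨x, hx, by rw [h.apply_orthogonal hn, hc]; module⟩, ?_⟩
  rintro μ ⟨v, hv, hμ⟩
  have h1 := h.one_lt_add
  have h2 := h.pos
  rcases h.eigenvalue_cases hv hμ with h | h | h <;> linarith

end IsBoost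

theorem exists_unitFutureNull {p : V} (hp : B p p = 0) (hp' : 0 < p 2) :
    ∃ a : ℝ, 0 < a ∧ IsUnitFutureNull (a • p) := by
  set q := p 0 ^ 2 + p 1 ^ 2 + p 2 ^ 2 with hq
  have hq0 : 0 < q := by positivity
  have hs0 : 0 < √q := Real.sqrt_pos.mpr hq0
  have hs : √q ^ 2 = q := Real.sq_sqrt hq0.le
  refine ⟨(√q)⁻¹, by positivity, ?_, ?_, ?_⟩
  · rw [B_smul_left, B_smul_right, hp]; simp
  · simp; positivity
  · simp only [Pi.smul_apply, smul_eq_mul, mul_pow]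
    rw [← mul_add, ← mul_add, ← hq, inv_pow, hs]
    field_simp

namespace IsBoost

variable {g : SO21} {n : V} {c s : ℝ}

/-- At a point `y` of the axis with unit tangent `cr n y`, the null directions are `y ± cr n y`. -/
theorem exists_isNullFrame (h : IsBoost g n c s) : ∃ Xm Xp, IsNullFrame g n Xm Xp := by
  obtain ⟨y, hy⟩ := exists_hyp_orthogonal (n := n) (by rw [h.unit]; norm_num)
  have hyy := y.B_self
  have hvy := B_cr_self_right n y.1
  have hnv := B_cr_self_left n y.1
  have hcc := h.cr_cr_orthogonal hy
  have hvv : B (cr n y.1) (cr n y.1) = 1 := by rw [B_cr_left, hcc, hyy]; norm_num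
  have hfut : ∀ p : V, B p p = 0 → B y.1 p = -1 → 0 < p 2 := fun p h1 h2 =>
    future_of_B_lt_zero (by linarith) y.pos h1.le (by linarith)
  have hp0 : B (y.1 + cr n y.1) (y.1 + cr n y.1) = 0 := by
    simp only [B_add_left, B_add_right, hyy, hvy, B_comm (cr n y.1) y.1, hvv]; norm_num
  have hm0 : B (y.1 - cr n y.1) (y.1 - cr n y.1) = 0 := by
    simp only [B_sub_left, B_sub_right, hyy, hvy, B_comm (cr n y.1) y.1, hvv]; norm_num
  obtain ⟨a, ha, hpa⟩ := exists_unitFutureNull hp0 (hfut _ hp0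
    (by rw [B_add_right, hyy, hvy]; simp))
  obtain ⟨b, hb, hmb⟩ := exists_unitFutureNull hm0 (hfut _ hm0
    (by rw [B_sub_right, hyy, hvy]; simp))
  have hne : ∀ {p : V}, IsUnitFutureNull p → p ≠ 0 := fun {p} hp h0 => by
    have := hp.2.1; rw [h0] at this; simp at this
  have hpn : B n (a • (y.1 + cr n y.1)) = 0 := by rw [B_smul_right, B_add_right, hy, hnv]; simp
  have hmn : B n (b • (y.1 - cr n y.1)) = 0 := by rw [B_smul_right, B_sub_right, hy, hnv]; simp
  have hpc : cr n (a • (y.1 + cr n y.1)) = a • (y.1 + cr n y.1) := by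
    rw [cr_smul_right, cr_add_right, hcc, add_comm]
  have hmc : cr n (b • (y.1 - cr n y.1)) = -(b • (y.1 - cr n y.1)) := by
    rw [cr_smul_right, cr_sub_right, hcc, ← smul_neg, neg_sub]
  have hL := h.isLeast (hne hmb) hmn hmc
  have hG := h.isGreatest (hne hpa) hpn hpc
  refine ⟨_, _, hmb, ⟨c - s, hL, ?_⟩, hpa, ⟨c + s, hG, ?_⟩, h.unit, h.fixed, ?_⟩
  · rw [h.apply_orthogonal hmn, hmc]; module
  · rw [h.apply_orthogonal hpn, hpc]; module
  · rw [det_of_eq, hmc, B_neg_left, B_smul_left, B_smul_right, B_sub_left, B_add_right, B_add_right,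
      hyy, hvy, B_comm (cr n y.1) y.1, hvy, hvv]
    have := mul_pos ha hb
    linarith

/-- Since `nullFrame` is an arbitrary choice of frame, uniqueness is what identifies `X0 g` with the
boost normal. The fixed line determines the normal up to sign, the orientation determines the sign.
-/
theorem eq_of_isNullFrame (h : IsBoost g n c s) {Z Xm Xp : V} (H : IsNullFrame g Z Xm Xp) :
    Z = n ∧ B n Xp = 0 ∧ cr n Xp = Xp := by
  have hne : ∀ {p : V}, IsUnitFutureNull p → p ≠ 0 := fun {p} hp h0 => by
    have := hp.2.1; rw [h0] at this; simp at this
  have hc1 := h.sub_lt_one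
  have hc2 := h.one_lt_add
  have hs := h.pos
  -- the extreme eigenvalues are `c ∓ s`
  have main : ∀ {Z Xm Xp : V}, IsNullFrame g Z Xm Xp →
      (B n Xm = 0 ∧ cr n Xm = -Xm) ∧ (B n Xp = 0 ∧ cr n Xp = Xp) := by
    intro Z Xm Xp H
    have h1 : (1 : ℝ) ∈ eigenvalues g := ⟨n, fun h0 => by
      have := h.unit; rw [h0, B_zero_left] at this; norm_num at this, by rw [h.fixed, one_smul]⟩
    obtain ⟨μ, hμ, hμ'⟩ := H.eigen_minus
    obtain ⟨ν, hν, hν'⟩ := H.eigen_plus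
    have key : ∃ y : V, y ≠ 0 ∧ B n y = 0 ∧ cr n y = -y := by
      obtain ⟨y, hy⟩ := exists_hyp_orthogonal (n := n) (by rw [h.unit]; norm_num)
      refine ⟨y.1 - cr n y.1, fun h0 => ?_, ?_, ?_⟩
      · have := congrArg (B y.1) h0
        rw [B_sub_right, y.B_self, B_cr_self_right, B_comm, B_zero_left] at this
        norm_num at this
      · rw [B_sub_right, hy, B_cr_self_left, sub_zero]
      · rw [cr_sub_right, h.cr_cr_orthogonal hy, neg_sub]
    have key' : ∃ y : V, y ≠ 0 ∧ B n y = 0 ∧ cr n y = y := by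
      obtain ⟨y, hy⟩ := exists_hyp_orthogonal (n := n) (by rw [h.unit]; norm_num)
      refine ⟨y.1 + cr n y.1, fun h0 => ?_, ?_, ?_⟩
      · have := congrArg (B y.1) h0
        rw [B_add_right, y.B_self, B_cr_self_right, B_comm, B_zero_left] at this
        norm_num at this
      · rw [B_add_right, hy, B_cr_self_left, add_zero]
      · rw [cr_add_right, h.cr_cr_orthogonal hy, add_comm]
    obtain ⟨y, hy0, hy1, hy2⟩ := key
    obtain ⟨z, hz0, hz1, hz2⟩ := key'
    have e1 := hμ.unique (h.isLeast hy0 hy1 hy2)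
    have e2 := hν.unique (h.isGreatest hz0 hz1 hz2)
    constructor
    · rcases h.eigenvalue_cases (hne H.null_minus) hμ' with h | h | h
      · linarith
      · linarith
      · exact ⟨h.1, h.2.1⟩
    · rcases h.eigenvalue_cases (hne H.null_plus) hν' with h | h | h
      · linarith
      · exact ⟨h.1, h.2.1⟩
      · linarith
  obtain ⟨⟨-, m2⟩, p1, p2⟩ := main H
  refine ⟨?_, p1, p2⟩
  -- a fixed vector is a multiple of `n`
  have hz : Z = B n Z • n := by
    have h1 := h.apply Z
    rw [H.eigen_zero] at h1
    set z := Z - B n Z • n with hzdef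
    have hzn : B n z = 0 := by rw [hzdef, B_sub_right, B_smul_right, h.unit]; ring
    have hcz : cr n z = cr n Z := by rw [hzdef, cr_sub_right, cr_smul_right, cr_self]; simp
    have h2 : mat g *ᵥ z = (1 : ℝ) • z := by
      rw [hzdef, Matrix.mulVec_sub, Matrix.mulVec_smul, h.fixed, H.eigen_zero, one_smul]
    by_contra hne'
    have hz0 : z ≠ 0 := sub_ne_zero.mpr hne'
    have h3 := h.apply_orthogonal hzn
    rw [h2, one_smul] at h3
    have h4 : (c - 1) • z = -(s • cr n z) := by rw [sub_smul, one_smul]; nth_rw 2 [h3]; abel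
    have h5 : (c - 1) • cr n z = -(s • z) := by
      have := congrArg (cr n) h4
      rw [cr_smul_right, ← neg_smul, cr_smul_right, h.cr_cr_orthogonal hzn, neg_smul] at this
      exact this
    have h6 : ((c - 1) ^ 2 - s ^ 2) • z = 0 := by
      linear_combination (norm := module) (c - 1) • h4 - s • h5
    have h7 := (smul_eq_zero.mp h6).resolve_right hz0
    nlinarith [h.one_lt, h.sq_sub_sq]
  have hsq : B n Z * B n Z = 1 := by
    have := H.unit_zero
    rw [hz, B_smul_left, B_smul_right, h.unit] at this
    linarith
  rcases mul_self_eq_one_iff.mp hsq with h1 | h1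
  · rw [hz, h1, one_smul]
  -- For `Z = -n` the determinant would equal `B Xm Xp`, which is not positive for future null
  -- vectors.
  · exfalso
    have ho := H.orientation
    rw [hz, h1, neg_one_smul, det_of_eq, cr_neg_left, m2, neg_neg] at ho
    linarith [B_le_zero_of_null H.null_minus.1 H.null_minus.2.1 H.null_plus.1 H.null_plus.2.1]

theorem nullFrame_spec (h : IsBoost g n c s) :
    IsNullFrame g (nullFrame g).1 (nullFrame g).2.1 (nullFrame g).2.2 := by
  obtain ⟨Xm, Xp, H⟩ := h.exists_isNullFrame
  exact Classical.epsilon_spec (p := fun F : V × V × V => IsNullFrame g F.1 F.2.1 F.2.2)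
    ⟨(n, Xm, Xp), H⟩

theorem X0_eq (h : IsBoost g n c s) : X0 g = n := (h.eq_of_isNullFrame h.nullFrame_spec).1

/-- The direction of the oriented axis at one of its points. -/
theorem unitTangent_eq (h : IsBoost g n c s) {y : Hyp} (hy : B n y.1 = 0) :
    unitTangent y (Xplus g) = cr n y.1 := by
  have H := h.nullFrame_spec
  obtain ⟨-, h1, h2⟩ := h.eq_of_isNullFrame H
  have hnull := H.null_plus
  change B n (Xplus g) = 0 at h1
  change cr n (Xplus g) = Xplus g at h2
  change IsUnitFutureNull (Xplus g) at hnull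
  rw [unitTangent]
  set ξ := Xplus g
  have hyξ := B_lt_zero_of_future (by linarith [y.B_self]) y.pos hnull.1.le hnull.2.1
  have hyy := y.B_self
  have hcc := h.cr_cr_orthogonal hy
  have hvv : B (cr n y.1) (cr n y.1) = 1 := by rw [B_cr_left, hcc, hyy]; norm_num
  have hvξ : B (cr n y.1) ξ = -B y.1 ξ := by rw [B_cr_left, h2]
  have hY0 : B (y.1 + cr n y.1) (y.1 + cr n y.1) = 0 := by
    simp only [B_add_left, B_add_right, hyy, B_cr_self_right, B_comm (cr n y.1) y.1, hvv]; norm_num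
  -- Both `y + cr n y` and `ξ` are null and orthogonal to each other, hence proportional; pairing
  -- with `y` fixes the scale.
  have hp := null_proportional hY0 hnull.1 (by rw [B_add_left, hvξ]; ring)
  have hp2 := congrArg (B y.1) hp
  rw [B_smul_right, B_smul_right, B_add_right, hyy, B_cr_self_right] at hp2
  have h3 := hnull.2.1
  have h4 : y.1 + cr n y.1 = (-(B y.1 ξ)⁻¹) • ξ := by
    apply smul_right_injective V h3.ne'
    simp only
    have h5 : (y.1 + cr n y.1) 2 = -ξ 2 / B y.1 ξ := by
      rw [eq_div_iff hyξ.ne]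
      linarith
    rw [hp, smul_smul, h5]
    congr 1
    ring
  rw [← h4]
  abel

end IsBoost

theorem IsHyperbolic.exists_isBoost {g : SO21} (h : IsHyperbolic g) :
    ∃ c s, IsBoost g (X0 g) c s := by
  obtain ⟨n, hn⟩ := exists_isBoost_of_trace h.three_lt_trace
  exact ⟨_, _, by rw [hn.X0_eq]; exact hn⟩

/-! ### Geodesics parametrized by arc length -/

/-- The unit speed geodesic with unit normal `n` through `y`. -/
noncomputable def geo (n y : V) (r : ℝ) : V := Real.cosh r • y + Real.sinh r • cr n y

theorem geo_zero (n y : V) : geo n y 0 = y := by simp [geo]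

theorem B_geo (m n y : V) (r : ℝ) :
    B m (geo n y r) = Real.cosh r * B m y + Real.sinh r * B m (cr n y) := by
  rw [geo, B_add_right, B_smul_right, B_smul_right]

theorem cr_cr_of_unit {n y : V} (hn : B n n = 1) (hny : B n y = 0) : cr n (cr n y) = y := by
  rw [cr_cr, hn, hny]
  module

theorem cr_geo {n y : V} (hn : B n n = 1) (hny : B n y = 0) (r : ℝ) :
    cr n (geo n y r) = Real.cosh r • cr n y + Real.sinh r • y := by
  rw [geo, cr_add_right, cr_smul_right, cr_smul_right, cr_cr_of_unit hn hny]

theorem B_geo_normal {n y : V} (hny : B n y = 0) (r : ℝ) : B n (geo n y r) = 0 := by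
  rw [B_geo, hny, B_cr_self_left]
  ring

theorem geo_add {n y : V} (hn : B n n = 1) (hny : B n y = 0) (r t : ℝ) :
    geo n y (r + t) = geo n (geo n y r) t := by
  rw [geo, geo, cr_geo hn hny, geo, Real.cosh_add, Real.sinh_add]
  module

theorem B_cr_cr_self {n y : V} (hn : B n n = 1) (hy : B y y = -1) (hny : B n y = 0) :
    B (cr n y) (cr n y) = 1 := by
  rw [B_cr_left, cr_cr_of_unit hn hny, hy, neg_neg]

theorem B_geo_self {n y : V} (hn : B n n = 1) (hy : B y y = -1) (hny : B n y = 0)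
    (r : ℝ) : B (geo n y r) (geo n y r) = -1 := by
  simp only [geo, B_add_left, B_add_right, B_smul_left, B_smul_right, B_cr_cr_self hn hy hny, hy,
    B_comm _ y, B_cr_self_right]
  linear_combination -Real.cosh_sq r

theorem B_self_geo {n y : V} (hy : B y y = -1) (r : ℝ) : B y (geo n y r) = -Real.cosh r := by
  rw [B_geo, hy, B_cr_self_right]
  ring

theorem geo_future {n y : V} (hn : B n n = 1) (hy : B y y = -1) (hny : B n y = 0)
    (hy' : 0 < y 2) (r : ℝ) : 0 < geo n y r 2 :=
  future_of_B_lt_zero (by linarith) hy' (by rw [B_geo_self hn hy hny]; norm_num)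
    (by rw [B_self_geo hy]; linarith [Real.cosh_pos r])

/-- The points of a geodesic are the values of its parametrization. -/
theorem exists_eq_geo {n : V} {y z : Hyp} (hn : B n n = 1) (hy : B n y.1 = 0) (hz : B n z.1 = 0) :
    ∃ r, z.1 = geo n y.1 r := by
  have hyy := y.B_self
  have hvv := B_cr_cr_self hn hyy hy
  -- After removing its components along `y` and `cr n y`, the vector `z` is a multiple of `n`, and
  -- it is orthogonal to `n` as well.
  have hm : z.1 + B y.1 z.1 • y.1 - B (cr n y.1) z.1 • cr n y.1 = 0 := by
    have := eq_smul_of_orthogonal (m := z.1 + B y.1 z.1 • y.1 - B (cr n y.1) z.1 • cr n y.1)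
      hn hyy hy
      (by
        simp only [B_add_left, B_sub_left, B_smul_left, hyy, B_comm (cr n y.1) y.1,
          B_cr_self_right, B_comm z.1 y.1]
        ring)
      (by
        simp only [B_add_left, B_sub_left, B_smul_left, hvv, B_cr_self_right,
          B_comm z.1 (cr n y.1)]
        ring)
    rw [this, B_comm]
    simp only [B_add_right, B_sub_right, B_smul_right, hy, hz, B_cr_self_left]
    simp
  have hz' : z.1 = (-B y.1 z.1) • y.1 + B (cr n y.1) z.1 • cr n y.1 := by
    linear_combination (norm := module) hm
  have hzz := z.B_self
  have h1 : B y.1 z.1 ^ 2 = 1 + B (cr n y.1) z.1 ^ 2 := by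
    rw [hz'] at hzz
    simp only [B_add_left, B_add_right, B_smul_left, B_smul_right, hyy, hvv, B_cr_self_right,
      B_comm (cr n y.1) y.1] at hzz
    linear_combination -hzz
  refine ⟨Real.arsinh (B (cr n y.1) z.1), ?_⟩
  have h2 := Hyp.one_le_neg_B y z
  rw [geo, Real.sinh_arsinh, Real.cosh_arsinh, ← h1, Real.sqrt_sq_eq_abs,
    abs_of_neg (by linarith)]
  exact hz'

/-- A point of the unit speed geodesic with unit normal `n` through `y`. -/
noncomputable def Hyp.geo {n : V} (hn : B n n = 1) {y : Hyp} (hy : B n y.1 = 0) (r : ℝ) : Hyp :=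
  ⟨AffineTwist.geo n y.1 r, B_geo_self hn y.B_self hy r, geo_future hn y.B_self hy y.pos r⟩

namespace IsBoost

variable {g : SO21} {n : V} {c s : ℝ}

theorem length_pos (h : IsBoost g n c s) : 0 < Real.arcosh c := Real.arcosh_pos h.one_lt

theorem cosh_length (h : IsBoost g n c s) : Real.cosh (Real.arcosh c) = c :=
  Real.cosh_arcosh h.one_lt.le

theorem sinh_length (h : IsBoost g n c s) : Real.sinh (Real.arcosh c) = s := by
  rw [Real.sinh_arcosh h.one_lt.le, show c ^ 2 - 1 = s ^ 2 by linarith [h.sq_sub_sq],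
    Real.sqrt_sq h.pos.le]

theorem mulVec_geo (h : IsBoost g n c s) {y : V} (hy : B n y = 0) (r : ℝ) :
    mat g *ᵥ geo n y r = geo n y (r + Real.arcosh c) := by
  rw [geo_add h.unit hy, h.apply_orthogonal (B_geo_normal hy r), geo.eq_def n (geo n y r),
    h.cosh_length, h.sinh_length]

theorem zpow_mulVec_geo (h : IsBoost g n c s) {y : V} (hy : B n y = 0) (r : ℝ) (k : ℤ) :
    mat (g ^ k) *ᵥ geo n y r = geo n y (r + k * Real.arcosh c) := by
  induction k generalizing r with
  | zero => simp [mat_one]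
  | succ k ih =>
    rw [zpow_add_one, mat_mulVec_mul, h.mulVec_geo hy, ih]
    congr 1
    push_cast
    ring
  | pred k ih =>
    have : mat g⁻¹ *ᵥ geo n y r = geo n y (r - Real.arcosh c) := by
      rw [← mat_inv_mulVec g (geo n y (r - Real.arcosh c)), h.mulVec_geo hy, sub_add_cancel]
    rw [zpow_sub_one, mat_mulVec_mul, this, ih]
    congr 1
    push_cast
    ring

theorem zpow_fixed (h : IsBoost g n c s) (k : ℤ) : mat (g ^ k) *ᵥ n = n := by
  induction k with
  | zero => simp [mat_one]
  | succ k ih => rw [zpow_add_one, mat_mulVec_mul, h.fixed, ih]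
  | pred k ih =>
    have : mat g⁻¹ *ᵥ n = n := by
      conv_lhs => rw [← h.fixed]
      exact mat_inv_mulVec g n
    rw [zpow_sub_one, mat_mulVec_mul, this, ih]

/-- Powers of a boost move a point of the axis into a fundamental segment. -/
theorem exists_zpow_mem_Ico (h : IsBoost g n c s) (y : V) (hy : B n y = 0) (r : ℝ) :
    ∃ k : ℤ, ∃ t ∈ Set.Ico 0 (Real.arcosh c), mat (g ^ k) *ᵥ geo n y r = geo n y t := by
  have hl := h.length_pos
  refine ⟨-⌊r / Real.arcosh c⌋, r - ⌊r / Real.arcosh c⌋ * Real.arcosh c, ⟨?_, ?_⟩, ?_⟩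
  · have := mul_le_mul_of_nonneg_right (Int.floor_le (r / Real.arcosh c)) hl.le
    rw [div_mul_cancel₀ _ hl.ne'] at this
    linarith
  · have := mul_lt_mul_of_pos_right (Int.lt_floor_add_one (r / Real.arcosh c)) hl
    rw [div_mul_cancel₀ _ hl.ne'] at this
    linarith
  · rw [h.zpow_mulVec_geo hy]
    congr 1
    push_cast
    ring

end IsBoost

theorem geo_two_le {n y : V} {r l : ℝ} (hy : 0 < y 2) (hr : 0 ≤ r) (hl : r ≤ l) :
    geo n y r 2 ≤ Real.cosh l * y 2 + Real.sinh l * |cr n y 2| := by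
  simp only [geo, Pi.add_apply, Pi.smul_apply, smul_eq_mul]
  have h1 : Real.cosh r ≤ Real.cosh l :=
    Real.cosh_le_cosh.mpr (by rwa [abs_of_nonneg hr, abs_of_nonneg (hr.trans hl)])
  have h2 : Real.sinh r ≤ Real.sinh l := Real.sinh_le_sinh.mpr hl
  have h3 : 0 ≤ Real.sinh r := Real.sinh_nonneg_iff.mpr hr
  have h4 := mul_le_mul_of_nonneg_right h1 hy.le
  have h5 := mul_le_mul_of_nonneg_left (le_abs_self (cr n y 2)) h3
  have h6 := mul_le_mul_of_nonneg_right h2 (abs_nonneg (cr n y 2))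
  linarith

/-! ### Proper discontinuity -/

theorem Hyp.two_le (z y : Hyp) : z.1 2 ≤ 2 * y.1 2 * -B z.1 y.1 := by
  have hy := y.one_le_two
  have hyy := y.B_self
  -- The second vector is the point reflection in `y` of the base point (0, 0, 1), so it is again
  -- future timelike.
  have h := B_lt_zero_of_future (x := z.1) (y := (2 * y.1 2) • y.1 - ![0, 0, 1])
    (by linarith [z.B_self]) z.pos
    (by
      have e : B y.1 ![0, 0, 1] = -y.1 2 := by simp [B]
      have e' : B ![0, 0, 1] ![0, 0, 1] = -1 := by simp [B]
      simp only [B_sub_left, B_sub_right, B_smul_left, B_smul_right, hyy, e, e',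
        B_comm ![0, 0, 1] y.1]
      nlinarith)
    (by simp; nlinarith)
  rw [B_sub_right, B_smul_right, show B z.1 ![0, 0, 1] = -z.1 2 by simp [B]] at h
  linarith

theorem mat_two_two_le (g : SO21) (x : Hyp) : mat g 2 2 ≤ 2 * x.1 2 * (g • x).1 2 := by
  let o : Hyp := ⟨![0, 0, 1], by simp [B], by simp⟩
  have h := Hyp.two_le (g • o) (g • x)
  rw [Hyp.smul_val, Hyp.smul_val, B_mat] at h
  simp [o, B, Matrix.mulVec, dotProduct, Fin.sum_univ_three] at h
  simp [Hyp.smul_val, Matrix.mulVec, dotProduct, Fin.sum_univ_three]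
  linarith

/-- Rows and columns are orthonormal for `B`, so the corner entry bounds the last row and column,
and these bound the rest. -/
theorem abs_mat_le {g : SO21} {C : ℝ} (hC : mat g 2 2 ≤ C) (i j : Fin 3) : |mat g i j| ≤ 1 + C := by
  have h22 : 0 < mat g 2 2 := by
    simpa [mat] using g.2.2 (Pi.single 2 1) (by simp [B]) (by simp)
  have hrow := B_mat g⁻¹ (Pi.single 2 1) (Pi.single 2 1)
  have hcol : ∀ j, B (mat g *ᵥ Pi.single j 1) (mat g *ᵥ Pi.single j 1) =
    B (Pi.single j 1) (Pi.single j 1) := fun j => B_mat g _ _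
  have h0 := hcol 0
  have h1 := hcol 1
  have h2 := hcol 2
  rw [mat_inv_eq] at hrow
  simp [B, Matrix.mul_apply, Matrix.diagonal_apply] at hrow h0 h1 h2
  apply abs_le_of_sq_le_sq _ (by linarith)
  have e : mat g 2 2 * mat g 2 2 ≤ C * C := mul_le_mul hC hC h22.le (by linarith)
  fin_cases i <;> fin_cases j <;> simp <;>
    nlinarith [sq_nonneg (mat g 0 0), sq_nonneg (mat g 0 1), sq_nonneg (mat g 0 2),
      sq_nonneg (mat g 1 0), sq_nonneg (mat g 1 1), sq_nonneg (mat g 1 2),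
      sq_nonneg (mat g 2 0), sq_nonneg (mat g 2 1)]

/-- Positivity of the time coordinate is replaced by the bound 1, which holds automatically on the
future sheet and is a closed condition. -/
theorem isClosedEmbedding_mat : Topology.IsClosedEmbedding mat := by
  refine ⟨Topology.IsEmbedding.subtypeVal.comp Topology.IsEmbedding.subtypeVal, ?_⟩
  have : Set.range mat = {A : Matrix (Fin 3) (Fin 3) ℝ | A.det = 1} ∩
      ((⋂ x : V, ⋂ y : V, {A | B (A *ᵥ x) (A *ᵥ y) = B x y}) ∩
      ⋂ x : Hyp, {A | 1 ≤ (A *ᵥ x.1) 2}) := by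
    ext A
    simp only [Set.mem_range, Set.mem_inter_iff, Set.mem_ofPred_eq, Set.mem_iInter]
    constructor
    · rintro ⟨g, rfl⟩
      exact ⟨det_mat g, B_mat g, fun x => (g • x).one_le_two⟩
    · rintro ⟨h1, h2, h3⟩
      exact ⟨⟨⟨A, h1⟩, h2, fun x hx hx' => zero_lt_one.trans_le (h3 ⟨x, hx, hx'⟩)⟩, rfl⟩
  rw [this]
  have hc : ∀ x : V, Continuous fun A : Matrix (Fin 3) (Fin 3) ℝ => A *ᵥ x := fun x =>
    continuous_id.matrix_mulVec continuous_const
  have hc' : ∀ (x : V) (i : Fin 3), Continuous fun A : Matrix (Fin 3) (Fin 3) ℝ => (A *ᵥ x) i :=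
    fun x i => (continuous_apply i).comp (hc x)
  refine (isClosed_eq continuous_id.matrix_det continuous_const).inter
    ((isClosed_iInter fun x => isClosed_iInter fun y => isClosed_eq ?_ continuous_const).inter
    (isClosed_iInter fun x => isClosed_le continuous_const (hc' x.1 2)))
  simp only [B]
  exact (((hc' x 0).mul (hc' y 0)).add ((hc' x 1).mul (hc' y 1))).sub ((hc' x 2).mul (hc' y 2))

/-- Proper discontinuity: a bound on the corner entry confines the matrices to a compact set, which
a discrete subgroup meets finitely often. -/
theorem finite_two_two_le (G : Subgroup SO21) [DiscreteTopology G] (C : ℝ) :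
    {g : G | mat g 2 2 ≤ C}.Finite := by
  have hK : IsCompact (mat ⁻¹' Set.pi Set.univ
      fun _ : Fin 3 => Set.pi Set.univ fun _ : Fin 3 => Set.Icc (-(1 + C)) (1 + C)) :=
    isClosedEmbedding_mat.isCompact_preimage
      (isCompact_univ_pi fun _ => isCompact_univ_pi fun _ => isCompact_Icc)
  have := (Subgroup.tendsto_coe_cofinite_of_discrete G ⟨‹_›⟩).eventually
    hK.compl_mem_cocompact
  rw [Filter.eventually_cofinite] at this
  refine this.subset fun g hg => ?_
  rw [Set.mem_ofPred_eq, not_not]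
  exact fun i _ j _ => abs_le.mp (abs_mat_le hg i j)

/-! ### Segments in the hyperbolic plane -/

/-- The point of the hyperbolic plane on the ray through a future timelike vector. -/
noncomputable def Hyp.normalize (p : V) (hp : B p p < 0) (hp' : 0 < p 2) : Hyp :=
  ⟨(√(-B p p))⁻¹ • p, by
    have h := Real.sq_sqrt (show 0 ≤ -B p p by linarith)
    have h0 : √(-B p p) ≠ 0 := (Real.sqrt_pos.mpr (by linarith)).ne'
    rw [B_smul_left, B_smul_right]
    field_simp
    linarith, by
    have h0 : 0 < √(-B p p) := Real.sqrt_pos.mpr (by linarith)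
    simp only [Pi.smul_apply, smul_eq_mul]
    positivity⟩

theorem Hyp.segment_le (x y : Hyp) {t : ℝ} (h0 : 0 ≤ t) (h1 : t ≤ 1) :
    B ((1 - t) • x.1 + t • y.1) ((1 - t) • x.1 + t • y.1) ≤ -1 := by
  simp only [B_add_left, B_add_right, B_smul_left, B_smul_right, x.B_self, y.B_self, B_comm y.1 x.1]
  have := Hyp.one_le_neg_B x y
  nlinarith [mul_nonneg h0 (sub_nonneg.mpr h1)]

theorem Hyp.segment_pos (x y : Hyp) {t : ℝ} (h0 : 0 ≤ t) (h1 : t ≤ 1) :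
    0 < ((1 - t) • x.1 + t • y.1) 2 := by
  simp only [Pi.add_apply, Pi.smul_apply, smul_eq_mul]
  have hx := x.one_le_two
  have hy := y.one_le_two
  nlinarith

/-- The point of the segment from `x` to `y` with parameter `t`. -/
noncomputable def Hyp.seg (x y : Hyp) (t : Set.Icc (0 : ℝ) 1) : Hyp :=
  Hyp.normalize ((1 - t.1) • x.1 + t.1 • y.1)
    (by linarith [Hyp.segment_le x y t.2.1 t.2.2]) (Hyp.segment_pos x y t.2.1 t.2.2)

theorem Hyp.B_seg (x y : Hyp) (t : Set.Icc (0 : ℝ) 1) : ∃ a : ℝ, 0 < a ∧ a ≤ 1 ∧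
    (Hyp.seg x y t).1 = a • ((1 - t.1) • x.1 + t.1 • y.1) := by
  have h := Hyp.segment_le x y t.2.1 t.2.2
  have h1 : 1 ≤ √(-B ((1 - t.1) • x.1 + t.1 • y.1) ((1 - t.1) • x.1 + t.1 • y.1)) :=
    Real.one_le_sqrt.mpr (by linarith)
  exact ⟨_, by positivity, inv_le_one_of_one_le₀ h1, rfl⟩

theorem Hyp.continuous_seg (x y : Hyp) : Continuous (Hyp.seg x y) := by
  apply Continuous.subtype_mk
  have h : Continuous fun t : Set.Icc (0 : ℝ) 1 => (1 - t.1) • x.1 + t.1 • y.1 := by fun_prop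
  have hi : ∀ i, Continuous fun t : Set.Icc (0 : ℝ) 1 => ((1 - t.1) • x.1 + t.1 • y.1) i :=
    fun i => (continuous_apply i).comp h
  refine Continuous.smul (Continuous.inv₀ (Real.continuous_sqrt.comp (Continuous.neg ?_))
    fun t => ?_) h
  · simp only [B]
    exact (((hi 0).mul (hi 0)).add ((hi 1).mul (hi 1))).sub ((hi 2).mul (hi 2))
  · have := Hyp.segment_le x y t.2.1 t.2.2
    exact (Real.sqrt_pos.mpr (neg_pos.mpr (by linarith))).ne'

theorem Hyp.seg_two_le (x y : Hyp) (t : Set.Icc (0 : ℝ) 1) :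
    (Hyp.seg x y t).1 2 ≤ max (x.1 2) (y.1 2) := by
  obtain ⟨a, h0, h1, h⟩ := Hyp.B_seg x y t
  rw [h]
  have h2 := Hyp.segment_pos x y t.2.1 t.2.2
  have h3 : (a • ((1 - t.1) • x.1 + t.1 • y.1)) 2 ≤ ((1 - t.1) • x.1 + t.1 • y.1) 2 := by
    rw [Pi.smul_apply, smul_eq_mul]
    nlinarith
  refine h3.trans ?_
  simp only [Pi.add_apply, Pi.smul_apply, smul_eq_mul]
  have h4 := mul_le_mul_of_nonneg_left (le_max_left (x.1 2) (y.1 2)) (sub_nonneg.mpr t.2.2)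
  have h5 := mul_le_mul_of_nonneg_left (le_max_right (x.1 2) (y.1 2)) t.2.1
  linarith

/-- A geodesic with `x` and `y` on different sides meets the segment from `x` to `y`. -/
theorem Hyp.exists_seg_zero {n : V} {x y : Hyp} (h : B n x.1 * B n y.1 ≤ 0) :
    ∃ t, B n (Hyp.seg x y t).1 = 0 := by
  have key : ∃ t ∈ Set.Icc (0 : ℝ) 1, (1 - t) * B n x.1 + t * B n y.1 = 0 := by
    by_cases hxy : B n x.1 = B n y.1
    · have : B n x.1 = 0 := by rw [← hxy] at h; nlinarith [sq_nonneg (B n x.1)]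
      exact ⟨0, by simp, by simp [this]⟩
    · have hd : B n x.1 - B n y.1 ≠ 0 := sub_ne_zero.mpr hxy
      refine ⟨B n x.1 / (B n x.1 - B n y.1), ⟨?_, ?_⟩, by field_simp; ring⟩
      · rw [← mul_div_mul_right _ _ hd]
        apply div_nonneg <;> nlinarith [sq_nonneg (B n x.1), sq_nonneg (B n x.1 - B n y.1)]
      · rw [← mul_div_mul_right _ _ hd, div_le_one (mul_self_pos.mpr hd)]
        nlinarith [sq_nonneg (B n y.1)]
  obtain ⟨t, ht, h0⟩ := key
  refine ⟨⟨t, ht⟩, ?_⟩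
  obtain ⟨a, -, -, h⟩ := Hyp.B_seg x y ⟨t, ht⟩
  rw [h, B_smul_right, B_add_right, B_smul_right, B_smul_right, h0, mul_zero]

theorem Hyp.seg_normal {n : V} {x y : Hyp} (hx : B n x.1 = 0) (hy : B n y.1 = 0)
    (t : Set.Icc (0 : ℝ) 1) : B n (Hyp.seg x y t).1 = 0 := by
  obtain ⟨a, -, -, h⟩ := Hyp.B_seg x y t
  rw [h, B_smul_right, B_add_right, B_smul_right, B_smul_right, hx, hy]
  ring

/-! ### The lifts of a simple closed geodesic -/

variable {G : Subgroup SO21}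

/-- The unit normals of the lifts of the closed geodesic `h`. -/
def normals (h : G) : Set V := Set.range fun g : G => mat g *ᵥ X0 h

theorem mat_coe_mul (g k : G) (x : V) : mat (g * k : G) *ᵥ x = mat g *ᵥ (mat k *ᵥ x) := by
  rw [Subgroup.coe_mul, mat_mulVec_mul]

theorem coe_smul_val (g : G) (x : Hyp) : (g • x).1 = mat g *ᵥ x.1 := rfl

theorem B_coe_smul (g : G) (n : V) (x : Hyp) : B (mat g *ᵥ n) (g • x).1 = B n x.1 :=
  B_mat _ _ _

theorem B_coe_left (g : G) (n : V) (x : Hyp) : B (mat g *ᵥ n) x.1 = B n (g⁻¹ • x).1 :=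
  B_mat_left _ _ _

theorem X0_mem_normals (h : G) : X0 h ∈ normals h := ⟨1, by simp [mat_one]⟩

theorem mat_mem_normals {h : G} {n : V} (hn : n ∈ normals h) (g : G) : mat g *ᵥ n ∈ normals h := by
  obtain ⟨k, rfl⟩ := hn
  exact ⟨g * k, mat_coe_mul g k _⟩

theorem mem_axis_iff {h : SO21} {x : Hyp} : x ∈ axis h ↔ B (X0 h) x.1 = 0 := by
  rw [B_comm]
  rfl

theorem mem_smul_axis {h g : G} {x : Hyp} :
    x ∈ g • axis (h : SO21) ↔ B (mat g *ᵥ X0 h) x.1 = 0 := by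
  rw [Set.mem_smul_set_iff_inv_smul_mem, B_coe_left, mem_axis_iff]

theorem IsSimple.ne_one {h : G} (hs : IsSimple h) : h ≠ 1 := fun h1 => by
  have := hs.primitive 1 2 (by rw [h1, one_pow])
  norm_num at this

theorem IsHoledSurfaceGroup.exists_isBoost (hG : IsHoledSurfaceGroup G) {h : G} (h1 : h ≠ 1) :
    ∃ c s, IsBoost (h : SO21) (X0 h) c s :=
  (hG.hyperbolic h h.2 fun h0 => h1 (Subtype.ext h0)).exists_isBoost

theorem B_X0_self (hG : IsHoledSurfaceGroup G) {h : G} (h1 : h ≠ 1) : B (X0 h) (X0 h) = 1 := by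
  obtain ⟨c, s, hb⟩ := hG.exists_isBoost h1
  exact hb.unit

theorem unit_of_mem_normals (hG : IsHoledSurfaceGroup G) {h : G} (h1 : h ≠ 1) {n : V}
    (hn : n ∈ normals h) : B n n = 1 := by
  obtain ⟨g, rfl⟩ := hn
  exact (B_mat _ _ _).trans (B_X0_self hG h1)

theorem exists_mem_axis (hG : IsHoledSurfaceGroup G) {h : G} (h1 : h ≠ 1) :
    ∃ a, a ∈ axis (h : SO21) := by
  simp only [mem_axis_iff]
  exact exists_hyp_orthogonal (by rw [B_X0_self hG h1]; norm_num)

/-- Two unit vectors that are orthogonal to the same geodesic agree up to sign. -/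
theorem eq_or_eq_neg_of_orthogonal {n m y : V} (hn : B n n = 1) (hm : B m m = 1) (hy : B y y = -1)
    (hny : B n y = 0) (hmy : B m y = 0) (hmv : B m (cr n y) = 0) : m = n ∨ m = -n := by
  have h := eq_smul_of_orthogonal hn hy hny hmy hmv
  have h2 : B m n * B m n = 1 := by
    have := hm
    rw [h, B_smul_left, B_smul_right, hn] at this
    linarith
  rcases mul_self_eq_one_iff.mp h2 with h3 | h3
  · left; rw [h, h3, one_smul]
  · right; rw [h, h3, neg_one_smul]

/-- No element of the group reverses a geodesic. -/
theorem mat_ne_neg (hG : IsHoledSurfaceGroup G) {n : V} (hn : B n n = 1) (g : G) :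
    mat g *ᵥ n ≠ -n := by
  intro h
  by_cases h1 : g = 1
  · rw [h1, Subgroup.coe_one, mat_one_mulVec] at h
    have := congrArg (B n) h
    rw [B_neg_right, hn] at this
    norm_num at this
  · obtain ⟨c, s, hb⟩ := hG.exists_isBoost h1
    have h2 := hb.B_normal n
    rw [h, B_neg_right] at h2
    have h3 : B (X0 g) n = 0 := by linarith
    have h4 := hb.apply_orthogonal h3
    rw [h] at h4
    have h5 := congrArg (B n) h4
    rw [B_neg_right, B_add_right, B_smul_right, B_smul_right, hn, B_cr_self_right] at h5
    linarith [hb.one_lt]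

theorem smul_axis_eq_iff (hG : IsHoledSurfaceGroup G) {h : G} (h1 : h ≠ 1) (g : G) :
    g • axis (h : SO21) = axis (h : SO21) ↔ mat g *ᵥ X0 h = X0 h := by
  constructor
  · intro hg
    have hn := B_X0_self hG h1
    obtain ⟨y, hy⟩ := exists_mem_axis hG h1
    have hmem : ∀ z ∈ axis (h : SO21), B (mat g *ᵥ X0 h) z.1 = 0 := fun z hz => by
      rw [← hg] at hz
      exact mem_smul_axis.mp hz
    have hy0 := mem_axis_iff.mp hy
    have h2 := hmem _ (show Hyp.geo hn hy0 1 ∈ axis (h : SO21) from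
      mem_axis_iff.mpr (B_geo_normal hy0 1))
    change B (mat g *ᵥ X0 h) (geo (X0 h) y.1 1) = 0 at h2
    rw [B_geo, hmem y hy, mul_zero, zero_add] at h2
    have h3 := (mul_eq_zero.mp h2).resolve_left (Real.sinh_pos_iff.mpr one_pos).ne'
    exact (eq_or_eq_neg_of_orthogonal hn ((B_mat _ _ _).trans hn) y.B_self hy0 (hmem y hy)
      h3).resolve_right (mat_ne_neg hG hn g)
  · intro hg
    ext x
    rw [mem_smul_axis, hg, mem_axis_iff]

/-- Embeddedness makes the two lifts coincide; their normals then agree, including the sign, because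
no element of `G` reverses an axis. -/
theorem eq_of_common_point (hG : IsHoledSurfaceGroup G) {h : G} (hs : IsSimple h) {n m : V}
    (hn : n ∈ normals h) (hm : m ∈ normals h) {x : Hyp} (hnx : B n x.1 = 0) (hmx : B m x.1 = 0) :
    n = m := by
  obtain ⟨g, rfl⟩ := hn
  obtain ⟨k, rfl⟩ := hm
  simp only at hnx hmx ⊢
  rcases hs.embedded (g⁻¹ * k) with h1 | h1
  · rw [smul_axis_eq_iff hG hs.ne_one, mat_coe_mul] at h1
    have := congrArg (mat g *ᵥ ·) h1
    rw [Subgroup.coe_inv, mat_mulVec_inv] at this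
    exact this.symm
  · exfalso
    refine Set.disjoint_left.mp h1 (show g⁻¹ • x ∈ _ from ?_) ?_
    · rw [mem_smul_axis, mat_coe_mul]
      exact (B_mat _ _ _).trans hmx
    · rw [B_coe_left] at hnx
      exact mem_axis_iff.mpr hnx

/-- Only finitely many lifts of a closed geodesic meet a bounded set. -/
theorem finite_normals (hG : IsHoledSurfaceGroup G) {h : G} (h1 : h ≠ 1) (C : ℝ) :
    {n ∈ normals h | ∃ x : Hyp, x.1 2 ≤ C ∧ B n x.1 = 0}.Finite := by
  have := hG.discrete
  obtain ⟨c, s, hb⟩ := hG.exists_isBoost h1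
  obtain ⟨y, hy⟩ := exists_mem_axis hG h1
  rw [mem_axis_iff] at hy
  set D := Real.cosh (Real.arcosh c) * y.1 2 + Real.sinh (Real.arcosh c) * |cr (X0 h) y.1 2|
  refine ((finite_two_two_le G (2 * D * C)).image fun g : G => mat g *ᵥ X0 h).subset ?_
  rintro _ ⟨⟨g, rfl⟩, x, hx, hgx⟩
  simp only [B_coe_left] at hgx
  obtain ⟨r, hr⟩ := exists_eq_geo hb.unit hy hgx
  obtain ⟨k, t, ht, hk⟩ := hb.exists_zpow_mem_Ico y.1 hy r
  -- Correcting by a power of `h` does not change the normal, and it brings the point on the axis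
  -- into one fundamental segment, where heights are bounded.
  refine ⟨g * (h ^ k)⁻¹, ?_, ?_⟩
  · have h2 := mat_two_two_le (g * (h ^ k)⁻¹ : G) ((h ^ k : G) • g⁻¹ • x)
    have e1 : ((g * (h ^ k)⁻¹ : G) : SO21) • ((h ^ k : G) • g⁻¹ • x) = x := by
      change (g * (h ^ k)⁻¹ : G) • ((h ^ k : G) • g⁻¹ • x) = x
      rw [smul_smul, smul_smul]
      simp
    have e2 : ((h ^ k : G) • g⁻¹ • x).1 = geo (X0 h) y.1 t := by
      rw [coe_smul_val, hr, Subgroup.coe_zpow, hk]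
    rw [e1, e2] at h2
    have h3 := geo_two_le (n := X0 h) y.pos ht.1 ht.2.le
    have h4 := geo_future hb.unit y.B_self hy y.pos t
    refine h2.trans ?_
    have h5 := x.pos
    exact mul_le_mul (by linarith) hx h5.le (by linarith)
  · simp only
    rw [mat_coe_mul, Subgroup.coe_inv, Subgroup.coe_zpow, ← zpow_neg, hb.zpow_fixed]

theorem finite_separating (hG : IsHoledSurfaceGroup G) {h : G} (h1 : h ≠ 1) (x y : Hyp) :
    {n ∈ normals h | B n x.1 * B n y.1 ≤ 0}.Finite := by
  refine (finite_normals hG h1 (max (x.1 2) (y.1 2))).subset ?_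
  rintro n ⟨hn, hxy⟩
  obtain ⟨t, ht⟩ := Hyp.exists_seg_zero hxy
  exact ⟨hn, _, Hyp.seg_two_le x y t, ht⟩

/-- Points of one lift lie on the same side of every other lift. -/
theorem same_side_of_lift (hG : IsHoledSurfaceGroup G) {h : G} (hs : IsSimple h) {n m : V}
    (hn : n ∈ normals h) (hm : m ∈ normals h) (hmn : m ≠ n) {a b : Hyp} (ha : B n a.1 = 0)
    (hb : B n b.1 = 0) : 0 < B m a.1 * B m b.1 := by
  by_contra hneg
  obtain ⟨t, ht⟩ := Hyp.exists_seg_zero (not_lt.mp hneg)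
  exact hmn (eq_of_common_point hG hs hm hn ht (Hyp.seg_normal ha hb t))

/-- One test point on the axis suffices, since no other lift separates points of the axis. -/
theorem adjacentToAxis_iff (hG : IsHoledSurfaceGroup G) {h : G} (hs : IsSimple h) {x a : Hyp}
    (ha : a ∈ axis (h : SO21)) :
    AdjacentToAxis h x ↔ ∀ m ∈ normals h, m ≠ X0 h → 0 < B m x.1 * B m a.1 := by
  constructor
  · rintro H _ ⟨g, rfl⟩ hne
    exact H g (fun h2 => hne ((smul_axis_eq_iff hG hs.ne_one g).mp h2)) a ha
  · intro H g hg b hb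
    have hne : mat g *ᵥ X0 h ≠ X0 h := fun h2 => hg ((smul_axis_eq_iff hG hs.ne_one g).mpr h2)
    have h1 := H _ ⟨g, rfl⟩ hne
    have h2 := same_side_of_lift hG hs (X0_mem_normals h) ⟨g, rfl⟩ hne (mem_axis_iff.mp ha)
      (mem_axis_iff.mp hb)
    simp only at h1 h2
    have h3 : 0 < (B (mat g *ᵥ X0 h) x.1 * B (mat g *ᵥ X0 h) b.1) *
        (B (mat g *ᵥ X0 h) a.1) ^ 2 := by
      linarith [mul_pos h1 h2]
    exact pos_of_mul_pos_left h3 (sq_nonneg _)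

/-- A point of the axis is pushed slightly along the normal `n`, to either side. Lifts other than
the axis keep their sign: only finitely many of them need to be considered, and none passes through
the starting point. -/
theorem exists_adjacent (hG : IsHoledSurfaceGroup G) {h : G} (hs : IsSimple h) :
    (∃ x, x ∈ leftRegion h) ∧ ∃ x, x ∈ rightRegion h := by
  obtain ⟨a, ha⟩ := exists_mem_axis hG hs.ne_one
  have hn := B_X0_self hG hs.ne_one
  have ha' := mem_axis_iff.mp ha
  set n := X0 h with hndef
  have hself : ∀ t : ℝ, B (a.1 + t • n) (a.1 + t • n) = t ^ 2 - 1 := fun t => by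
    simp only [B_add_left, B_add_right, B_smul_left, B_smul_right, hn, ha', a.B_self, B_comm a.1 n]
    ring
  have hB : ∀ t : ℝ, B a.1 (a.1 + t • n) = -1 := fun t => by
    rw [B_add_right, B_smul_right, B_comm a.1 n, ha', a.B_self]; ring
  have hlt : ∀ t : ℝ, |t| < 1 → B (a.1 + t • n) (a.1 + t • n) < 0 := fun t ht => by
    rw [hself]; linarith [(sq_lt_one_iff_abs_lt_one t).mpr ht]
  have hpos : ∀ t : ℝ, |t| < 1 → 0 < (a.1 + t • n) 2 := fun t ht =>
    future_of_B_lt_zero (by linarith [a.B_self]) a.pos (hlt t ht).le (by rw [hB]; norm_num)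
  have h12 : |(1 / 2 : ℝ)| < 1 := by rw [abs_of_pos] <;> norm_num
  have h12' : |(-1 / 2 : ℝ)| < 1 := by rw [abs_of_neg] <;> norm_num
  let p := Hyp.normalize _ (hlt _ h12) (hpos _ h12)
  let q := Hyp.normalize _ (hlt _ h12') (hpos _ h12')
  have hsign : ∀ (m : V) (t : ℝ) (ht : |t| < 1),
      ∃ b : ℝ, 0 < b ∧ B m (Hyp.normalize _ (hlt t ht) (hpos t ht)).1 = b * B m (a.1 + t • n) :=
    fun m t ht => ⟨_, inv_pos.mpr (Real.sqrt_pos.mpr (neg_pos.mpr (hlt t ht))), B_smul_right _ _ _⟩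
  have hev : ∀ᶠ t : ℝ in nhds 0, |t| < 1 / 2 ∧
      ∀ m ∈ normals h, m ≠ n → 0 < B m (a.1 + t • n) * B m a.1 := by
    have hfin := (finite_separating hG hs.ne_one p a).union (finite_separating hG hs.ne_one q a)
    have h1 : ∀ᶠ t : ℝ in nhds 0, |t| < 1 / 2 :=
      (continuous_abs.tendsto (0 : ℝ)).eventually_lt_const (by norm_num)
    have h2 := (Filter.eventually_all_finite hfin (l := nhds (0 : ℝ))
      (p := fun m t => m ≠ n → 0 < B m (a.1 + t • n) * B m a.1)).mpr (by
        intro m hm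
        have hm' : m ∈ normals h := by rcases hm with hm | hm <;> exact hm.1
        by_cases hmn : m = n
        · exact Filter.Eventually.of_forall fun t h => absurd hmn h
        · have hc : Continuous fun t : ℝ => B m (a.1 + t • n) * B m a.1 := by
            simp only [B_add_right, B_smul_right]
            fun_prop
          have h0 := same_side_of_lift hG hs (X0_mem_normals h) hm' hmn ha' ha'
          have := (hc.tendsto 0).eventually_const_lt (u := 0) (by simpa using h0)
          exact this.mono fun t ht _ => ht)
    filter_upwards [h1, h2] with t ht1 ht2
    refine ⟨ht1, fun m hm hmn => ?_⟩
    -- A lift separating `a` from neither `p` nor `q` (the parameters ±1/2) cannot separate it from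
    -- the points between them, because `B m (a + t n)` is affine in `t`; the others form a finite
    -- set.
    by_cases hmem : m ∈ {n ∈ normals h | B n p.1 * B n a.1 ≤ 0} ∪
        {n ∈ normals h | B n q.1 * B n a.1 ≤ 0}
    · exact ht2 m hmem hmn
    · have e1 : 0 < B m p.1 * B m a.1 := by
        by_contra hh
        exact hmem (Or.inl ⟨hm, not_lt.mp hh⟩)
      have e2 : 0 < B m q.1 * B m a.1 := by
        by_contra hh
        exact hmem (Or.inr ⟨hm, not_lt.mp hh⟩)
      obtain ⟨b, hb, hb'⟩ := hsign m _ h12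
      obtain ⟨d, hd, hd'⟩ := hsign m _ h12'
      change B m p.1 = _ at hb'
      change B m q.1 = _ at hd'
      rw [hb', mul_assoc] at e1
      rw [hd', mul_assoc] at e2
      have e3 := pos_of_mul_pos_right e1 hb.le
      have e4 := pos_of_mul_pos_right e2 hd.le
      rw [B_add_right, B_smul_right] at e3 e4 ⊢
      have := abs_lt.mp ht1
      have e5 := mul_nonneg (by linarith : 0 ≤ 1 / 2 + t) e3.le
      have e6 := mul_nonneg (by linarith : 0 ≤ 1 / 2 - t) e4.le
      rcases le_or_gt 0 t with h0 | h0
      · have := mul_pos (by linarith : 0 < 1 / 2 + t) e3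
        linarith
      · have := mul_pos (by linarith : 0 < 1 / 2 - t) e4
        linarith
  have hmem : ∀ t : ℝ, (|t| < 1 / 2 ∧
      ∀ m ∈ normals h, m ≠ n → 0 < B m (a.1 + t • n) * B m a.1) →
      ∃ (x : Hyp) (b : ℝ), 0 < b ∧ B n x.1 = b * t ∧ AdjacentToAxis h x := by
    rintro t ⟨ht1, ht2⟩
    have ht : |t| < 1 := by linarith
    obtain ⟨b, hb, hb'⟩ := hsign n t ht
    refine ⟨_, b, hb, hb'.trans ?_, (adjacentToAxis_iff hG hs ha).mpr fun m hm hmn => ?_⟩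
    · rw [B_add_right, B_smul_right, hn, ha']; ring
    · obtain ⟨d, hd, hd'⟩ := hsign m t ht
      rw [hd', mul_assoc]
      exact mul_pos hd (ht2 m hm hmn)
  constructor
  · obtain ⟨t, ht, ht0⟩ := ((hev.filter_mono (nhdsWithin_le_nhds (s := Set.Ioi 0))).and
      self_mem_nhdsWithin).exists
    obtain ⟨x, b, hb, hx, hadj⟩ := hmem t ht
    exact ⟨x, by rw [← hndef, hx]; exact mul_pos hb (Set.mem_Ioi.mp ht0), hadj⟩
  · obtain ⟨t, ht, ht0⟩ := ((hev.filter_mono (nhdsWithin_le_nhds (s := Set.Iio 0))).and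
      self_mem_nhdsWithin).exists
    obtain ⟨x, b, hb, hx, hadj⟩ := hmem t ht
    exact ⟨x, by rw [← hndef, hx]; exact mul_neg_of_pos_of_neg hb (Set.mem_Iio.mp ht0), hadj⟩

/-! ### The jump across the lifts of a closed geodesic -/

/-- The indicator of the left side of the geodesic with normal `n`. -/
noncomputable def side (n : V) (x : Hyp) : ℝ := if 0 < B n x.1 then 1 else 0

/-- The sum of the normals of the lifts of `h` that separate `x` from `y`, counted with sign. -/
noncomputable def jump (h : G) (x y : Hyp) : V :=
  ∑ᶠ n ∈ normals h, (side n y - side n x) • n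

theorem side_smul (g : G) (n : V) (x : Hyp) : side (mat g *ᵥ n) (g • x) = side n x := by
  rw [side, B_coe_smul, side]

theorem side_eq_of_mul_pos {n : V} {x y : Hyp} (h : 0 < B n x.1 * B n y.1) :
    side n x = side n y := by
  rw [side, side]
  rcases pos_and_pos_or_neg_and_neg_of_mul_pos h with h | h
  · rw [if_pos h.1, if_pos h.2]
  · rw [if_neg h.1.not_gt, if_neg h.2.not_gt]

theorem finite_side_ne (hG : IsHoledSurfaceGroup G) {h : G} (h1 : h ≠ 1) (x y : Hyp) :
    {n ∈ normals h | side n x ≠ side n y}.Finite := by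
  refine (finite_separating hG h1 x y).subset ?_
  rintro n ⟨hn, hne⟩
  exact ⟨hn, not_lt.mp fun h => hne (side_eq_of_mul_pos h)⟩

theorem finite_support_jump (hG : IsHoledSurfaceGroup G) {h : G} (h1 : h ≠ 1) (x y : Hyp) :
    (normals h ∩ Function.support fun n => (side n y - side n x) • n).Finite := by
  refine (finite_side_ne hG h1 x y).subset ?_
  rintro n ⟨hn, hne⟩
  refine ⟨hn, fun h0 => hne ?_⟩
  simp [h0]

/-- The differences of `side` telescope, even when a point lies on a lift. -/
theorem jump_add (hG : IsHoledSurfaceGroup G) {h : G} (h1 : h ≠ 1) (x y z : Hyp) :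
    jump h x z = jump h x y + jump h y z := by
  rw [jump, jump, jump, ← finsum_mem_add_distrib' (finite_support_jump hG h1 x y)
    (finite_support_jump hG h1 y z)]
  refine finsum_mem_congr rfl fun n _ => ?_
  module

theorem jump_self (h : G) (x : Hyp) : jump h x x = 0 := by simp [jump]

theorem jump_swap (hG : IsHoledSurfaceGroup G) {h : G} (h1 : h ≠ 1) (x y : Hyp) :
    jump h y x = -jump h x y := by
  rw [eq_neg_iff_add_eq_zero, ← jump_add hG h1, jump_self]

theorem jump_smul (hG : IsHoledSurfaceGroup G) {h : G} (h1 : h ≠ 1) (g : G) (x y : Hyp) :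
    jump h (g • x) (g • y) = mat g *ᵥ jump h x y := by
  let L : V →+ V := (Matrix.mulVecLin (mat g)).toAddMonoidHom
  have hL : ∀ v, L v = mat g *ᵥ v := fun v => rfl
  rw [jump, jump, ← hL, L.map_finsum_mem' (finite_support_jump hG h1 x y)]
  refine (finsum_mem_eq_of_bijOn (fun n => mat g *ᵥ n) ⟨fun n hn => mat_mem_normals hn g,
    fun n _ m _ hnm => ?_, fun n hn => ⟨mat (g⁻¹ : G) *ᵥ n, mat_mem_normals hn _, ?_⟩⟩
    fun n _ => ?_).symm
  · simp only at hnm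
    rw [← mat_inv_mulVec g n, hnm, mat_inv_mulVec]
  · exact mat_mulVec_inv _ _
  · rw [hL, Matrix.mulVec_smul, side_smul, side_smul]

theorem isCocycle_jump (hG : IsHoledSurfaceGroup G) {h : G} (h1 : h ≠ 1) (o : Hyp) :
    IsCocycle fun g : G => jump h o (g • o) := fun g₁ g₂ => by
  beta_reduce
  rw [jump_add hG h1 o (g₁ • o), mul_smul, jump_smul hG h1, add_comm]

/-! ### The two regions next to the axis -/

theorem mul_pos_of_adjacent (hG : IsHoledSurfaceGroup G) {h : G} (hs : IsSimple h) {x y : Hyp}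
    (hx : AdjacentToAxis h x) (hy : AdjacentToAxis h y) {m : V} (hm : m ∈ normals h)
    (hmn : m ≠ X0 h) : 0 < B m x.1 * B m y.1 := by
  obtain ⟨a, ha⟩ := exists_mem_axis hG hs.ne_one
  have h1 := (adjacentToAxis_iff hG hs ha).mp hx m hm hmn
  have h2 := (adjacentToAxis_iff hG hs ha).mp hy m hm hmn
  have h3 : 0 < (B m x.1 * B m y.1) * (B m a.1) ^ 2 := by linarith [mul_pos h1 h2]
  exact pos_of_mul_pos_left h3 (sq_nonneg _)

theorem adjacent_of_mul_pos (hG : IsHoledSurfaceGroup G) {h : G} (hs : IsSimple h) {x y : Hyp}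
    (hx : AdjacentToAxis h x) (hxy : ∀ m ∈ normals h, 0 < B m x.1 * B m y.1) :
    AdjacentToAxis h y := by
  obtain ⟨a, ha⟩ := exists_mem_axis hG hs.ne_one
  rw [adjacentToAxis_iff hG hs ha] at hx ⊢
  intro m hm hmn
  have h3 : 0 < (B m y.1 * B m a.1) * (B m x.1) ^ 2 := by
    linarith [mul_pos (hx m hm hmn) (hxy m hm)]
  exact pos_of_mul_pos_left h3 (sq_nonneg _)

theorem jump_right_left (hG : IsHoledSurfaceGroup G) {h : G} (hs : IsSimple h) {o p : Hyp}
    (ho : o ∈ rightRegion h) (hp : p ∈ leftRegion h) : jump h o p = X0 h := by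
  rw [jump]
  have : ∀ n, n ∈ normals h ∧ n ≠ X0 h → (side n p - side n o) • n = 0 := fun n hn => by
    rw [side_eq_of_mul_pos (mul_pos_of_adjacent hG hs hp.2 ho.2 hn.1 hn.2), sub_self, zero_smul]
  have e : ∑ᶠ n ∈ normals h, (side n p - side n o) • n =
      ∑ᶠ n ∈ ({X0 h} : Set V), (side n p - side n o) • n := by
    refine finsum_mem_inter_support_eq _ _ _ (Set.ext fun n => ⟨fun hn => ⟨?_, hn.2⟩, ?_⟩)
    · by_contra hne
      exact hn.2 (this n ⟨hn.1, hne⟩)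
    · rintro ⟨rfl, hn⟩
      exact ⟨X0_mem_normals h, hn⟩
  have h1 : side (X0 h) p = 1 := if_pos hp.1
  have h2 : side (X0 h) o = 0 := if_neg ho.1.not_gt
  rw [e, finsum_mem_singleton, h1, h2, sub_zero, one_smul]

/-- `D` is one of the two regions that border the axis of `h`. -/
def IsSideRegion (h : G) (D : Set Hyp) : Prop := D = leftRegion h ∨ D = rightRegion h

theorem IsSideRegion.adjacent {h : G} {D : Set Hyp} (hD : IsSideRegion h D) {x : Hyp}
    (hx : x ∈ D) : AdjacentToAxis h x := by
  rcases hD with rfl | rfl <;> exact hx.2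

theorem IsSideRegion.ne_zero (hG : IsHoledSurfaceGroup G) {h : G} (hs : IsSimple h) {D : Set Hyp}
    (hD : IsSideRegion h D) {x : Hyp} (hx : x ∈ D) {m : V} (hm : m ∈ normals h) :
    B m x.1 ≠ 0 := by
  by_cases hmn : m = X0 h
  · subst hmn
    rcases hD with rfl | rfl
    · exact hx.1.ne'
    · exact hx.1.ne
  · have := mul_pos_of_adjacent hG hs (hD.adjacent hx) (hD.adjacent hx) hm hmn
    intro h0
    rw [h0, mul_zero] at this
    exact this.false

/-- Describing a region by its signs against all normals makes it visible that `G`, which permutes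
the normals, maps such regions to each other. -/
theorem IsSideRegion.mem_iff (hG : IsHoledSurfaceGroup G) {h : G} (hs : IsSimple h) {D : Set Hyp}
    (hD : IsSideRegion h D) {x : Hyp} (hx : x ∈ D) {y : Hyp} :
    y ∈ D ↔ ∀ m ∈ normals h, 0 < B m x.1 * B m y.1 := by
  constructor
  · intro hy m hm
    by_cases hmn : m = X0 h
    · subst hmn
      rcases hD with rfl | rfl
      · exact mul_pos hx.1 hy.1
      · exact mul_pos_of_neg_of_neg hx.1 hy.1
    · exact mul_pos_of_adjacent hG hs (hD.adjacent hx) (hD.adjacent hy) hm hmn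
  · intro H
    have hadj := adjacent_of_mul_pos hG hs (hD.adjacent hx) H
    have h0 := H _ (X0_mem_normals h)
    rcases hD with rfl | rfl
    · exact ⟨pos_of_mul_pos_right h0 hx.1.le, hadj⟩
    · exact ⟨neg_of_mul_pos_right h0 hx.1.le, hadj⟩

theorem IsSideRegion.smul_mem (hG : IsHoledSurfaceGroup G) {h : G} (hs : IsSimple h)
    {D D' : Set Hyp} (hD : IsSideRegion h D) (hD' : IsSideRegion h D') {x : Hyp} (hx : x ∈ D)
    {g : G} (hgx : g • x ∈ D') {y : Hyp} (hy : y ∈ D) : g • y ∈ D' := by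
  refine (hD'.mem_iff hG hs hgx).mpr fun m hm => ?_
  have h1 := (hD.mem_iff hG hs hx).mp hy _ (mat_mem_normals hm g⁻¹)
  rw [B_coe_left, B_coe_left, inv_inv] at h1
  exact h1

theorem IsSideRegion.mem_stabilizer (hG : IsHoledSurfaceGroup G) {h : G} (hs : IsSimple h)
    {D : Set Hyp} (hD : IsSideRegion h D) {x : Hyp} (hx : x ∈ D) {g : G} (hgx : g • x ∈ D) :
    g ∈ MulAction.stabilizer G D := by
  rw [MulAction.mem_stabilizer_iff]
  apply Set.Subset.antisymm
  · rintro _ ⟨y, hy, rfl⟩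
    exact hD.smul_mem hG hs hD hx hgx hy
  · intro y hy
    rw [Set.mem_smul_set_iff_inv_smul_mem]
    exact hD.smul_mem hG hs hD hgx (by rwa [inv_smul_smul]) hy

theorem smul_mem_of_mem_stabilizer {D : Set Hyp} {g : G} (hg : g ∈ MulAction.stabilizer G D)
    {x : Hyp} (hx : x ∈ D) : g • x ∈ D := by
  rw [MulAction.mem_stabilizer_iff] at hg
  rw [← hg]
  exact Set.smul_mem_smul_set hx

/-- The jump between two points of one region vanishes. -/
theorem IsSideRegion.jump_eq_zero (hG : IsHoledSurfaceGroup G) {h : G} (hs : IsSimple h)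
    {D : Set Hyp} (hD : IsSideRegion h D) {x y : Hyp} (hx : x ∈ D) (hy : y ∈ D) :
    jump h x y = 0 := by
  rw [jump]
  refine finsum_mem_eq_zero_of_forall_eq_zero fun n hn => ?_
  rw [side_eq_of_mul_pos ((hD.mem_iff hG hs hx).mp hy n hn), sub_self, zero_smul]

/-- For `g` in the left group, pass from `o` to `p` to `g • p` to `g • o`, with `p` on the left of
the axis: the three jumps are `X0 h`, zero and `-g X0 h`. -/
theorem isAffineTwist_jump (hG : IsHoledSurfaceGroup G) {h : G} (hs : IsSimple h) {o : Hyp}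
    (ho : o ∈ rightRegion h) : IsAffineTwist h fun g : G => jump h o (g • o) := by
  obtain ⟨p, hp⟩ := (exists_adjacent hG hs).1
  refine ⟨isCocycle_jump hG hs.ne_one o, fun g hg => ?_, fun g hg => ?_⟩
  · exact IsSideRegion.jump_eq_zero hG hs (Or.inr rfl) ho (smul_mem_of_mem_stabilizer hg ho)
  · have hgp := smul_mem_of_mem_stabilizer hg hp
    rw [jump_add hG hs.ne_one o p, jump_add hG hs.ne_one p (g • p),
      IsSideRegion.jump_eq_zero hG hs (Or.inl rfl) hp hgp, jump_right_left hG hs ho hp,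
      jump_smul hG hs.ne_one, jump_swap hG hs.ne_one, jump_right_left hG hs ho hp,
      Matrix.mulVec_neg]
    abel

/-! ### Moving points into the two regions -/

/-- On the straight segment from `o` to `x`, take the separating lift with the smallest crossing
parameter. No other lift can lie between `o` and this one. -/
theorem exists_first_crossing (hG : IsHoledSurfaceGroup G) {h : G} (hs : IsSimple h) {o x : Hyp}
    (ho : ∀ m ∈ normals h, B m o.1 ≠ 0)
    (hne : ∃ m ∈ normals h, B m o.1 * B m x.1 < 0) :
    ∃ n ∈ normals h, B n o.1 * B n x.1 < 0 ∧ ∀ m ∈ normals h, m ≠ n →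
      ∀ a : Hyp, B n a.1 = 0 → 0 < B m o.1 * B m a.1 := by
  have hfin : {m ∈ normals h | B m o.1 * B m x.1 < 0}.Finite :=
    (finite_separating hG hs.ne_one o x).subset fun m hm => ⟨hm.1, hm.2.le⟩
  obtain ⟨n, ⟨hn, hnx⟩, hmin⟩ := Set.exists_min_image _
    (fun m => B m o.1 / (B m o.1 - B m x.1)) hfin (by obtain ⟨m, h1, h2⟩ := hne; exact ⟨m, h1, h2⟩)
  have hcoef : ∀ m : V, B m o.1 * B m x.1 < 0 → 0 < B m o.1 * (B m o.1 - B m x.1) := fun m h => by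
    nlinarith [sq_nonneg (B m o.1)]
  have hdne : ∀ m : V, B m o.1 * B m x.1 < 0 → B m o.1 - B m x.1 ≠ 0 := fun m h h0 => by
    have := hcoef m h
    rw [h0, mul_zero] at this
    exact this.false
  set t := B n o.1 / (B n o.1 - B n x.1) with ht
  have hd := hdne n hnx
  have ht0 : 0 ≤ t := by
    rw [ht, ← mul_div_mul_right _ _ hd]
    exact div_nonneg (hcoef n hnx).le (mul_self_nonneg _)
  have ht1 : t ≤ 1 := by
    rw [ht, ← mul_div_mul_right _ _ hd, div_le_one (mul_self_pos.mpr hd)]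
    nlinarith [sq_nonneg (B n x.1)]
  obtain ⟨b, hb, -, hz⟩ := Hyp.B_seg o x ⟨t, ht0, ht1⟩
  set z := Hyp.seg o x ⟨t, ht0, ht1⟩
  have hBz : ∀ m, B m z.1 = b * (B m o.1 - t * (B m o.1 - B m x.1)) := fun m => by
    rw [hz, B_smul_right, B_add_right, B_smul_right, B_smul_right]
    ring
  have hnz : B n z.1 = 0 := by rw [hBz, ht, div_mul_cancel₀ _ hd]; ring
  refine ⟨n, hn, hnx, fun m hm hmn a ha => ?_⟩
  have hside := same_side_of_lift hG hs hn hm hmn hnz ha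
  have hoz : 0 < B m o.1 * B m z.1 := by
    rw [hBz]
    -- Minimality yields only the weak inequality; it becomes strict because `z` lies on the lift
    -- `n`, which is disjoint from `m`.
    have key : 0 ≤ B m o.1 * (B m o.1 - t * (B m o.1 - B m x.1)) := by
      by_cases hmx : B m o.1 * B m x.1 < 0
      · have h1 := hmin m ⟨hm, hmx⟩
        have h2 := mul_le_mul_of_nonneg_right h1 (hcoef m hmx).le
        have h3 : B m o.1 / (B m o.1 - B m x.1) * (B m o.1 * (B m o.1 - B m x.1)) =
            B m o.1 * B m o.1 := by
          have := hdne m hmx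
          field_simp
        rw [h3] at h2
        linarith
      · nlinarith [mul_nonneg ht0 (not_lt.mp hmx),
          mul_nonneg (sub_nonneg.mpr ht1) (mul_self_nonneg (B m o.1))]
    have hzne : B m z.1 ≠ 0 := fun h0 => by
      rw [h0, zero_mul] at hside
      exact hside.false
    rw [hBz] at hzne
    have h4 : B m o.1 * (B m o.1 - t * (B m o.1 - B m x.1)) ≠ 0 :=
      mul_ne_zero (ho m hm) (right_ne_zero_of_mul hzne)
    have h5 := mul_pos hb (lt_of_le_of_ne key h4.symm)
    linarith
  have h3 : 0 < (B m o.1 * B m a.1) * (B m z.1) ^ 2 := by linarith [mul_pos hoz hside]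
  exact pos_of_mul_pos_left h3 (sq_nonneg _)

/-- The regions next to lifts of `h` cover the complement of the lifts: every point off the lifts
can be moved into a region next to the axis of `h`, by any subgroup containing all elements that
move one such region to another. -/
theorem exists_smul_mem_region (hG : IsHoledSurfaceGroup G) {h : G} (hs : IsSimple h)
    (Γ : Subgroup G)
    (hΓ : ∀ (D D' : Set Hyp), IsSideRegion h D → IsSideRegion h D' → ∀ (g : G), ∀ x ∈ D,
      g • x ∈ D' → g ∈ Γ)
    {x : Hyp} (hx : ∀ m ∈ normals h, B m x.1 ≠ 0) :
    ∃ γ ∈ Γ, γ • x ∈ leftRegion h ∨ γ • x ∈ rightRegion h := by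
  suffices H : ∀ (N : ℕ) (D : Set Hyp), IsSideRegion h D → ∀ o ∈ D, ∀ x : Hyp,
      (∀ m ∈ normals h, B m x.1 ≠ 0) →
      {m ∈ normals h | B m o.1 * B m x.1 < 0}.ncard = N →
      ∃ γ ∈ Γ, γ • x ∈ leftRegion h ∨ γ • x ∈ rightRegion h by
    obtain ⟨o, ho⟩ := (exists_adjacent hG hs).1
    exact H _ _ (Or.inl rfl) o ho x hx rfl
  intro N
  -- Induction on the number of lifts between `o` and `x`. The first one is moved to the axis of
  -- `h`, and the reference point is replaced by a point `p` on the far side.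
  induction N using Nat.strong_induction_on with
  | _ N ih =>
    intro D hD o ho x hx hN
    by_cases hne : ∃ m ∈ normals h, B m o.1 * B m x.1 < 0
    · obtain ⟨n, ⟨g, hg⟩, hnx, hfirst⟩ := exists_first_crossing hG hs
        (fun m hm => hD.ne_zero hG hs ho hm) hne
      simp only at hg
      subst hg
      obtain ⟨a, ha⟩ := exists_mem_axis hG hs.ne_one
      have hadj : AdjacentToAxis h (g⁻¹ • o) := by
        rw [adjacentToAxis_iff hG hs ha]
        intro m hm hmn
        have h1 := hfirst (mat g *ᵥ m) (mat_mem_normals hm g)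
          (fun h0 => hmn (by rw [← mat_inv_mulVec g m, h0, mat_inv_mulVec])) (g • a)
          (by rw [B_coe_smul]; exact mem_axis_iff.mp ha)
        rwa [B_coe_left, B_coe_smul] at h1
      rw [B_coe_left, B_coe_left] at hnx
      have hex : ∃ D₁ D₂, IsSideRegion h D₁ ∧ IsSideRegion h D₂ ∧ g⁻¹ • o ∈ D₁ ∧
          ∃ p ∈ D₂, B (X0 h) p.1 * B (X0 h) (g⁻¹ • o).1 < 0 := by
        obtain ⟨⟨p, hp⟩, ⟨q, hq⟩⟩ := exists_adjacent hG hs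
        rcases lt_or_gt_of_ne (left_ne_zero_of_mul hnx.ne) with h0 | h0
        · exact ⟨_, _, Or.inr rfl, Or.inl rfl, ⟨h0, hadj⟩, p, hp, mul_neg_of_pos_of_neg hp.1 h0⟩
        · exact ⟨_, _, Or.inl rfl, Or.inr rfl, ⟨h0, hadj⟩, q, hq, mul_neg_of_neg_of_pos hq.1 h0⟩
      obtain ⟨D₁, D₂, hD₁, hD₂, hgo, p, hp, hpo⟩ := hex
      have hgΓ := hΓ D D₁ hD hD₁ g⁻¹ o ho hgo
      have hfin : {m ∈ normals h | B m o.1 * B m x.1 < 0}.Finite :=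
        (finite_separating hG hs.ne_one o x).subset fun m hm => ⟨hm.1, hm.2.le⟩
      have hinj : Function.Injective fun m : V => mat g *ᵥ m := fun m m' hm => by
        simp only at hm
        rw [← mat_inv_mulVec g m, hm, mat_inv_mulVec]
      -- Translated back by `g`, the lifts separating `p` from `g⁻¹ • x` are among the old ones, and
      -- the lift just crossed has dropped out.
      have hlt : {m ∈ normals h | B m p.1 * B m (g⁻¹ • x).1 < 0}.ncard < N := by
        rw [← hN, ← Set.ncard_image_of_injective _ hinj]
        refine Set.ncard_lt_ncard ⟨?_, fun hsub => ?_⟩ hfin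
        · rintro _ ⟨m, ⟨hm, hmx⟩, rfl⟩
          refine ⟨mat_mem_normals hm g, ?_⟩
          rw [B_coe_left, B_coe_left]
          have hmn : m ≠ X0 h := fun h0 => by
            rw [h0] at hmx
            have := mul_pos_of_neg_of_neg hmx hnx
            nlinarith [mul_neg_of_neg_of_pos hpo (mul_self_pos.mpr (right_ne_zero_of_mul hnx.ne))]
          have h1 := mul_pos_of_adjacent hG hs (hD₂.adjacent hp) hadj hm hmn
          have h2 : (B m (g⁻¹ • o).1 * B m (g⁻¹ • x).1) * (B m p.1) ^ 2 < 0 := by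
            linarith [mul_neg_of_pos_of_neg h1 hmx]
          by_contra hge
          linarith [mul_nonneg (not_lt.mp hge) (sq_nonneg (B m p.1))]
        · obtain ⟨m, ⟨hm, hmx⟩, hmg⟩ := hsub (a := mat g *ᵥ X0 h)
            ⟨⟨g, rfl⟩, by rw [B_coe_left, B_coe_left]; exact hnx⟩
          have := hinj hmg
          subst this
          have := mul_pos_of_neg_of_neg hmx hnx
          nlinarith [mul_neg_of_neg_of_pos hpo (mul_self_pos.mpr (right_ne_zero_of_mul hnx.ne))]
      obtain ⟨γ, hγ, hγx⟩ := ih _ hlt D₂ hD₂ p hp (g⁻¹ • x) (fun m hm => by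
        rw [← B_coe_left]; exact hx _ (mat_mem_normals hm g)) rfl
      exact ⟨γ * g⁻¹, Γ.mul_mem hγ hgΓ, by rwa [mul_smul]⟩
    · have hxD : x ∈ D := (hD.mem_iff hG hs ho).mpr fun m hm => by
        refine lt_of_le_of_ne (not_lt.mp fun h0 => hne ⟨m, hm, h0⟩) ?_
        exact (mul_ne_zero (hD.ne_zero hG hs ho hm) (hx m hm)).symm
      refine ⟨1, Γ.one_mem, ?_⟩
      rw [one_smul]
      rcases hD with rfl | rfl
      · exact Or.inl hxD
      · exact Or.inr hxD

/-! ### Separation and uniqueness -/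

theorem isPreconnected_rightRegion (hG : IsHoledSurfaceGroup G) {h : G} (hs : IsSimple h) :
    IsPreconnected (rightRegion h) := by
  refine isPreconnected_of_forall_pair fun x hx y hy => ?_
  have hR : IsSideRegion h (rightRegion h) := Or.inr rfl
  refine ⟨Set.range (Hyp.seg x y), ?_, ?_, ?_, isPreconnected_range (Hyp.continuous_seg x y)⟩
  · rintro _ ⟨t, rfl⟩
    rw [hR.mem_iff hG hs hx]
    intro m hm
    have h1 := (hR.mem_iff hG hs hx).mp hx m hm
    have h2 := (hR.mem_iff hG hs hx).mp hy m hm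
    obtain ⟨b, hb, -, hb'⟩ := Hyp.B_seg x y t
    rw [hb', B_smul_right, B_add_right, B_smul_right, B_smul_right]
    have h3 : 0 < (1 - t.1) * (B m x.1 * B m x.1) + t.1 * (B m x.1 * B m y.1) := by
      rcases t.2.1.lt_or_eq with h0 | h0
      · have := mul_nonneg (sub_nonneg.mpr t.2.2) h1.le
        have := mul_pos h0 h2
        linarith
      · rw [← h0]; linarith
    have := mul_pos hb h3
    linarith
  · refine ⟨⟨0, by simp⟩, Subtype.ext ?_⟩
    simp [Hyp.seg, Hyp.normalize, x.B_self]
  · refine ⟨⟨1, by simp⟩, Subtype.ext ?_⟩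
    simp [Hyp.seg, Hyp.normalize, y.B_self]

theorem mk_mem_curve {h : G} {x : Hyp} :
    (Quotient.mk _ x : Surface G) ∈ curve h ↔ ∃ m ∈ normals h, B m x.1 = 0 := by
  constructor
  · rintro ⟨a, ha, hax⟩
    obtain ⟨g, rfl⟩ := MulAction.orbitRel_apply.mp (Quotient.exact hax)
    refine ⟨mat (g⁻¹ : G) *ᵥ X0 h, ⟨g⁻¹, rfl⟩, ?_⟩
    rw [B_coe_left, inv_inv]
    exact mem_axis_iff.mp ha
  · rintro ⟨_, ⟨g, rfl⟩, h0⟩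
    refine ⟨g⁻¹ • x, mem_axis_iff.mpr ?_, Quotient.sound (MulAction.orbitRel_apply.mpr ⟨g⁻¹, rfl⟩)⟩
    rw [← B_coe_left]
    exact h0

/-- Otherwise every point off the lifts could be moved into the right region, so the complement of
the curve would be the image of a convex, hence connected, set. -/
theorem smul_notMem_rightRegion (hG : IsHoledSurfaceGroup G) {h : G} (hs : IsSimple h)
    (hsep : IsSeparating h) {x : Hyp} (hx : x ∈ leftRegion h) (g : G) :
    g • x ∉ rightRegion h := by
  intro hgx
  apply hsep
  have hL : IsSideRegion h (leftRegion h) := Or.inl rfl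
  have hR : IsSideRegion h (rightRegion h) := Or.inr rfl
  have : (curve h)ᶜ = Quotient.mk (MulAction.orbitRel G Hyp) '' rightRegion h := by
    ext q
    induction q using Quotient.inductionOn with
    | _ y =>
      rw [Set.mem_compl_iff, mk_mem_curve]
      constructor
      · intro hy
        obtain ⟨γ, -, hγ⟩ := exists_smul_mem_region hG hs ⊤ (fun _ _ _ _ _ _ _ _ => trivial)
          (x := y) fun m hm h0 => hy ⟨m, hm, h0⟩
        rcases hγ with hγ | hγ
        · refine ⟨g • γ • y, hL.smul_mem hG hs hR hx hgx hγ,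
            Quotient.sound (MulAction.orbitRel_apply.mpr ⟨g * γ, ?_⟩)⟩
          exact mul_smul _ _ _
        · exact ⟨γ • y, hγ, Quotient.sound (MulAction.orbitRel_apply.mpr ⟨γ, rfl⟩)⟩
      · rintro ⟨z, hz, hzy⟩ ⟨m, hm, h0⟩
        obtain ⟨k, rfl⟩ := MulAction.orbitRel_apply.mp (Quotient.exact hzy)
        refine hR.ne_zero hG hs hz (mat_mem_normals hm k) ?_
        exact (B_coe_smul k m y).trans h0
  rw [this]
  exact (isPreconnected_rightRegion hG hs).image _ continuous_quotient_mk'.continuousOn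

/-- Because left and right regions are never exchanged, each step of `exists_smul_mem_region` lies
in one of the two stabilizers. Applied to `g • o` it ends in the right region again, so `γ * g`
stabilizes that region. -/
theorem leftGroup_sup_rightGroup (hG : IsHoledSurfaceGroup G) {h : G} (hs : IsSimple h)
    (hsep : IsSeparating h) : leftGroup h ⊔ rightGroup h = ⊤ := by
  have hL : IsSideRegion h (leftRegion h) := Or.inl rfl
  have hR : IsSideRegion h (rightRegion h) := Or.inr rfl
  have hleft : leftGroup h ≤ leftGroup h ⊔ rightGroup h := le_sup_left
  have hright : rightGroup h ≤ leftGroup h ⊔ rightGroup h := le_sup_right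
  obtain ⟨o, ho⟩ := (exists_adjacent hG hs).2
  rw [eq_top_iff]
  intro g _
  obtain ⟨γ, hγ, hγo⟩ := exists_smul_mem_region hG hs (leftGroup h ⊔ rightGroup h) (by
    rintro D D' hD hD' k x hx hkx
    rcases hD with rfl | rfl <;> rcases hD' with rfl | rfl
    · exact hleft (hL.mem_stabilizer hG hs hx hkx)
    · exact absurd hkx (smul_notMem_rightRegion hG hs hsep hx k)
    · exact absurd (by rwa [inv_smul_smul]) (smul_notMem_rightRegion hG hs hsep hkx k⁻¹)
    · exact hright (hR.mem_stabilizer hG hs hx hkx)) (x := g • o) (fun m hm => by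
      rw [← inv_inv g, ← B_coe_left]
      exact hR.ne_zero hG hs ho (mat_mem_normals hm _))
  rw [smul_smul] at hγo
  rcases hγo with hγo | hγo
  · exact absurd (by rwa [inv_smul_smul]) (smul_notMem_rightRegion hG hs hsep hγo (γ * g)⁻¹)
  · exact (Subgroup.mul_mem_cancel_left _ hγ).mp (hright (hR.mem_stabilizer hG hs ho hγo))

theorem IsCocycle.map_one {u : G → V} (hu : IsCocycle u) : u 1 = 0 := by
  have := hu 1 1
  rw [mul_one, Subgroup.coe_one, mat_one_mulVec] at this
  simpa using this

theorem IsCocycle.eq_on_sup {u v : G → V} (hu : IsCocycle u) (hv : IsCocycle v)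
    {S : Subgroup G} {T : Subgroup G} (hS : ∀ g ∈ S, u g = v g) (hT : ∀ g ∈ T, u g = v g)
    (g : G) (hg : g ∈ S ⊔ T) : u g = v g := by
  let E : Subgroup G :=
    { carrier := {g | u g = v g}
      one_mem' := hu.map_one.trans hv.map_one.symm
      mul_mem' := fun {a b} ha hb => by
        change u (a * b) = v (a * b)
        rw [hu, hv, show u a = v a from ha, show u b = v b from hb]
      inv_mem' := fun {a} ha => by
        have h1 := hu a⁻¹ a
        have h2 := hv a⁻¹ a
        rw [inv_mul_cancel, hu.map_one] at h1
        rw [inv_mul_cancel, hv.map_one, ← show u a = v a from ha, h1] at h2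
        exact add_left_cancel h2 }
  exact sup_le (c := E) (fun g hg => hS g hg) (fun g hg => hT g hg) hg

theorem IsAffineTwist.unique (hG : IsHoledSurfaceGroup G) {h : G} (hs : IsSimple h)
    (hsep : IsSeparating h) {u v : G → V} (hu : IsAffineTwist h u) (hv : IsAffineTwist h v) :
    u = v := by
  ext1 g
  refine hu.cocycle.eq_on_sup hv.cocycle (S := leftGroup h) (T := rightGroup h)
    (fun g hg => by rw [hu.left g hg, hv.left g hg])
    (fun g hg => by rw [hu.right g hg, hv.right g hg]) g ?_
  rw [leftGroup_sup_rightGroup hG hs hsep]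
  trivial

/-! ### Angles -/

theorem Hyp.B_self_nonneg_of_orthogonal (y : Hyp) {x : V} (h : B y.1 x = 0) : 0 ≤ B x x := by
  by_contra hneg
  rw [not_le] at hneg
  have hy : B y.1 y.1 < 0 := by linarith [y.B_self]
  rcases lt_trichotomy (x 2) 0 with h0 | h0 | h0
  · have := B_lt_zero_of_future hy y.pos (y := -x) (by rw [B_neg_left, B_neg_right]; linarith)
      (by simpa using h0)
    rw [B_neg_right] at this
    linarith
  · simp only [B, h0] at hneg
    nlinarith [sq_nonneg (x 0), sq_nonneg (x 1)]
  · have := B_lt_zero_of_future hy y.pos hneg.le h0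
    linarith

/-- The cosine of the angle between two axes in terms of their unit normals. -/
theorem cos_angle {g k : SO21} {m n : V} {c s c' s' : ℝ} (hg : IsBoost g m c s)
    (hk : IsBoost k n c' s') {y : Hyp} (hm : B m y.1 = 0) (hn : B n y.1 = 0) :
    Real.cos (angle g k y) = if 0 < B m (cr n y.1) then B m n else -B m n := by
  have hdet : (Matrix.of ![y.1, cr m y.1, cr n y.1]).det = B m (cr n y.1) := by
    rw [det_of_eq, cr_comm m y.1, ← neg_one_smul ℝ (cr y.1 m), cr_smul_right, cr_cr, y.B_self,
      B_comm y.1 m, hm]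
    simp
  have hB : B (cr m y.1) (cr n y.1) = B m n := by
    rw [B_cr_left, cr_cr, hm, B_sub_right, B_smul_right, B_smul_right, y.B_self]
    ring
  -- Nonnegativity of the squares of `m ± n` gives `|B m n| ≤ 1`, needed to cancel `Real.arccos`.
  have h1 := y.B_self_nonneg_of_orthogonal (x := m + n)
    (by rw [B_add_right, B_comm, hm, B_comm, hn, add_zero])
  have h2 := y.B_self_nonneg_of_orthogonal (x := m - n)
    (by rw [B_sub_right, B_comm, hm, B_comm, hn, sub_zero])
  simp only [B_add_left, B_add_right, B_sub_left, B_sub_right, hg.unit, hk.unit,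
    B_comm n m] at h1 h2
  rw [angle, hg.unitTangent_eq hm, hk.unitTangent_eq hn]
  simp only [hdet]
  split_ifs with h
  · rw [hB, Real.cos_arccos (by linarith) (by linarith)]
  · rw [B_neg_right, hB, Real.cos_arccos (by linarith) (by linarith)]

/-! ### Crossings -/

theorem X0_conj (hG : IsHoledSurfaceGroup G) {h : G} (h1 : h ≠ 1) (g : G) :
    X0 (g * h * g⁻¹ : G) = mat g *ᵥ X0 h := by
  obtain ⟨c, s, hb⟩ := hG.exists_isBoost h1
  exact (hb.conj (g : SO21)).X0_eq

theorem X0_mem_normals_of_isConj (hG : IsHoledSurfaceGroup G) {h : G} (h1 : h ≠ 1) {k : G}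
    (hk : IsConj h k) : X0 k ∈ normals h := by
  obtain ⟨g, rfl⟩ := isConj_iff.mp hk
  exact ⟨g, (X0_conj hG h1 g).symm⟩

/-- Conjugates of `h` are boosts with the same `c` and `s`, so the normal alone determines them. -/
theorem eq_of_X0_eq (hG : IsHoledSurfaceGroup G) {h : G} (h1 : h ≠ 1) {k l : G}
    (hk : IsConj h k) (hl : IsConj h l) (hX : X0 (k : SO21) = X0 (l : SO21)) : k = l := by
  obtain ⟨c, s, hb⟩ := hG.exists_isBoost h1
  obtain ⟨g, rfl⟩ := isConj_iff.mp hk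
  obtain ⟨g', rfl⟩ := isConj_iff.mp hl
  rw [X0_conj hG h1, X0_conj hG h1] at hX
  have e1 := hb.conj (g : SO21)
  have e2 := hb.conj (g' : SO21)
  rw [← hX] at e2
  exact Subtype.ext (e1.ext e2)

theorem axis_eq_of_X0 {g k : SO21} (h : X0 g = X0 k ∨ X0 g = -X0 k) : axis g = axis k := by
  ext x
  rw [mem_axis_iff, mem_axis_iff]
  rcases h with h | h <;> rw [h]
  rw [B_neg_left, neg_eq_zero]

/-- The derivative of the height of the axis of `σ` over a transverse geodesic is nonzero. -/
theorem Crossing.B_cr_ne_zero (hG : IsHoledSurfaceGroup G) {h σ : G} (h1 : h ≠ 1) (hσ : σ ≠ 1)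
    (p : Crossing h σ) : B (X0 p.lift) (cr (X0 σ) p.point.1) ≠ 0 := fun h0 =>
  p.transverse (axis_eq_of_X0 (eq_or_eq_neg_of_orthogonal (B_X0_self hG hσ)
    (unit_of_mem_normals hG h1 (X0_mem_normals_of_isConj hG h1 p.isConj)) p.point.B_self
    (mem_axis_iff.mp p.mem_axis) (mem_axis_iff.mp p.mem_lift) h0))

theorem cr_geo_eq {n y : V} (hn : B n n = 1) (hny : B n y = 0) (m : V) (r t : ℝ)
    (h : B m (geo n y r) = 0) : B m (geo n y t) = Real.sinh (t - r) * B m (cr n (geo n y r)) := by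
  rw [show t = r + (t - r) by ring, geo_add hn hny, B_geo, h]
  ring_nf

theorem Crossing.point_eq (hG : IsHoledSurfaceGroup G) {h σ : G} (h1 : h ≠ 1) (hσ : σ ≠ 1)
    (p : Crossing h σ) {x : Hyp} (hx : B (X0 σ) x.1 = 0) (hx' : B (X0 p.lift) x.1 = 0) :
    x = p.point := by
  have hn := B_X0_self hG hσ
  have hp := mem_axis_iff.mp p.mem_axis
  obtain ⟨r, hr⟩ := exists_eq_geo hn hp hx
  rw [hr, B_geo, mem_axis_iff.mp p.mem_lift, mul_zero, zero_add] at hx'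
  have h0 := (mul_eq_zero.mp hx').resolve_right (p.B_cr_ne_zero hG h1 hσ)
  rw [Real.sinh_eq_zero] at h0
  rw [h0, geo_zero] at hr
  exact Subtype.ext hr

theorem Crossing.eq_of_X0_eq (hG : IsHoledSurfaceGroup G) {h σ : G} (h1 : h ≠ 1) (hσ : σ ≠ 1)
    {p q : Crossing h σ} (hpq : X0 (p.lift : SO21) = X0 (q.lift : SO21)) : p = q := by
  have hl := AffineTwist.eq_of_X0_eq hG h1 p.isConj q.isConj hpq
  have hp := q.point_eq hG h1 hσ (mem_axis_iff.mp p.mem_axis)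
    (by rw [← hpq]; exact mem_axis_iff.mp p.mem_lift)
  cases p
  cases q
  simp only at hl hp
  subst hl hp
  rfl

/-- The cosine of the angle at a crossing. -/
theorem Crossing.cos_angle (hG : IsHoledSurfaceGroup G) {h σ : G} (h1 : h ≠ 1) (hσ : σ ≠ 1)
    (p : Crossing h σ) : Real.cos (angle p.lift σ p.point) =
      if 0 < B (X0 p.lift) (cr (X0 σ) p.point.1) then B (X0 p.lift) (X0 σ)
      else -B (X0 p.lift) (X0 σ) := by
  obtain ⟨c, s, hb⟩ := hG.exists_isBoost (h := p.lift) fun h0 => h1 (by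
    have := p.isConj
    rwa [h0, isConj_one_left] at this)
  obtain ⟨c', s', hb'⟩ := hG.exists_isBoost hσ
  exact AffineTwist.cos_angle hb hb' (mem_axis_iff.mp p.mem_lift) (mem_axis_iff.mp p.mem_axis)

/-- Representatives differ by powers of `σ`, which fix `X0 σ` and preserve `B` and `cr`. -/
theorem Intersection.cos_angle_mk (hG : IsHoledSurfaceGroup G) {h σ : G} (h1 : h ≠ 1)
    (hσ : σ ≠ 1) (p : Crossing h σ) :
    Real.cos (Intersection.angle (Quotient.mk (crossingSetoid h σ) p)) =
      if 0 < B (X0 p.lift) (cr (X0 σ) p.point.1) then B (X0 p.lift) (X0 σ)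
      else -B (X0 p.lift) (X0 σ) := by
  refine (Crossing.cos_angle hG h1 hσ _).trans ?_
  obtain ⟨k, hk1, hk2⟩ := Quotient.mk_out (s := crossingSetoid h σ) p
  set q := Quotient.out (Quotient.mk (crossingSetoid h σ) p)
  obtain ⟨c, s, hb⟩ := hG.exists_isBoost hσ
  have hfix : mat (σ ^ k : G) *ᵥ X0 σ = X0 σ := by rw [Subgroup.coe_zpow, hb.zpow_fixed]
  have hq1 : q.lift ≠ 1 := fun h0 => h1 (by
    have := q.isConj
    rwa [h0, isConj_one_left] at this)
  have e1 : B (X0 p.lift) (cr (X0 σ) p.point.1) = B (X0 q.lift) (cr (X0 σ) q.point.1) := by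
    rw [hk1, hk2, X0_conj hG hq1, coe_smul_val]
    nth_rw 1 [← hfix]
    rw [← mat_cr, B_mat]
  have e2 : B (X0 p.lift) (X0 σ) = B (X0 q.lift) (X0 σ) := by
    rw [hk1, X0_conj hG hq1]
    nth_rw 1 [← hfix]
    rw [B_mat]
  rw [e1, e2]

/-- There is a point on the axis of `σ` that lies on no transverse lift of `h`. -/
theorem exists_generic_mem_axis (hG : IsHoledSurfaceGroup G) {h σ : G} (h1 : h ≠ 1)
    (hσ : σ ≠ 1) : ∃ y : Hyp, B (X0 σ) y.1 = 0 ∧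
      ∀ m ∈ normals h, B m y.1 = 0 → m = X0 σ ∨ m = -X0 σ := by
  have hn := B_X0_self hG hσ
  obtain ⟨y, hy⟩ := exists_mem_axis hG hσ
  rw [mem_axis_iff] at hy
  set n := X0 σ
  set C := Real.cosh 1 * y.1 2 + Real.sinh 1 * |cr n y.1 2|
  have hF := finite_normals hG h1 C
  have hbad : (⋃ m ∈ {m ∈ normals h | ∃ x : Hyp, x.1 2 ≤ C ∧ B m x.1 = 0},
      {r : ℝ | ¬ (m = n ∨ m = -n) ∧ B m (geo n y.1 r) = 0}).Finite := by
    -- The height along the axis over a transverse lift is a multiple of sinh(t - r), so each lift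
    -- excludes at most one parameter.
    refine hF.biUnion fun m hm => Set.Subsingleton.finite ?_
    rintro r ⟨hr1, hr2⟩ t ⟨-, ht⟩
    by_contra hne
    rw [cr_geo_eq hn hy m r t hr2] at ht
    have h0 := (mul_eq_zero.mp ht).resolve_left fun h0 =>
      hne (by rw [Real.sinh_eq_zero] at h0; linarith)
    exact hr1 (eq_or_eq_neg_of_orthogonal hn (unit_of_mem_normals hG h1 hm.1)
      (B_geo_self hn y.B_self hy r) (B_geo_normal hy r) hr2 h0)
  obtain ⟨r, hr, hr'⟩ := (Set.Icc_infinite (zero_lt_one (α := ℝ))).exists_notMem_finite hbad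
  refine ⟨Hyp.geo hn hy r, B_geo_normal hy r, fun m hm h0 => ?_⟩
  by_contra hne
  exact hr' (Set.mem_biUnion (x := m) ⟨hm, Hyp.geo hn hy r, geo_two_le y.pos hr.1 hr.2, h0⟩
    ⟨hne, h0⟩)

/-! ### Crossings within one period of the axis -/

section count

variable {h σ : G} {c s : ℝ} {y : Hyp}

/-- The lifts of `h` that separate `y` from `σ y`. -/
def separating (h σ : G) (y : Hyp) : Set V := {m ∈ normals h | side m y ≠ side m (σ • y)}

theorem side_of_crossing {n y m : V} {r t : ℝ} {x : Hyp} (hn : B n n = 1) (hny : B n y = 0)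
    (hx : x.1 = geo n y t) (h0 : B m (geo n y r) = 0) :
    side m x = if 0 < Real.sinh (t - r) * B m (cr n (geo n y r)) then 1 else 0 := by
  rw [side, hx, cr_geo_eq hn hny m r t h0]

theorem side_crossing (hb : IsBoost (σ : SO21) (X0 σ) c s) (hy : B (X0 σ) y.1 = 0) {m : V} {r : ℝ}
    (hr : r ∈ Set.Ioo 0 (Real.arcosh c)) (h0 : B m (geo (X0 σ) y.1 r) = 0)
    (hne : B m (cr (X0 σ) (geo (X0 σ) y.1 r)) ≠ 0) :
    side m (σ • y) - side m y = if 0 < B m (cr (X0 σ) (geo (X0 σ) y.1 r)) then 1 else -1 := by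
  have hσy : (σ • y).1 = geo (X0 σ) y.1 (Real.arcosh c) := by
    have := hb.mulVec_geo hy 0
    rwa [geo_zero, zero_add] at this
  rw [side_of_crossing hb.unit hy hσy h0,
    side_of_crossing (x := y) hb.unit hy (geo_zero _ _).symm h0]
  have h1 : 0 < Real.sinh (Real.arcosh c - r) := Real.sinh_pos_iff.mpr (by linarith [hr.2])
  have h2 : Real.sinh (0 - r) < 0 := Real.sinh_neg_iff.mpr (by linarith [hr.1])
  rcases lt_or_gt_of_ne hne with h3 | h3
  · rw [if_neg (mul_neg_of_pos_of_neg h1 h3).not_gt, if_pos (mul_pos_of_neg_of_neg h2 h3),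
      if_neg h3.not_gt]
    norm_num
  · rw [if_pos (mul_pos h1 h3), if_neg (mul_neg_of_neg_of_pos h2 h3).not_gt, if_pos h3]
    norm_num

theorem exists_crossing_of_separating (hG : IsHoledSurfaceGroup G) (h1 : h ≠ 1)
    (hb : IsBoost (σ : SO21) (X0 σ) c s) (hy : B (X0 σ) y.1 = 0)
    (hgen : ∀ m ∈ normals h, B m y.1 = 0 → m = X0 σ ∨ m = -X0 σ) {m : V}
    (hm : m ∈ separating h σ y) : ∃ p : Crossing h σ, X0 (p.lift : SO21) = m ∧
      ∃ r ∈ Set.Ioo 0 (Real.arcosh c), p.point.1 = geo (X0 σ) y.1 r := by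
  obtain ⟨hmn, hside⟩ := hm
  have hσy : (σ • y).1 = geo (X0 σ) y.1 (Real.arcosh c) := by
    have := hb.mulVec_geo hy 0
    rwa [geo_zero, zero_add] at this
  have hσn : B (X0 σ) (σ • y).1 = 0 := by rw [hσy]; exact B_geo_normal hy _
  have hpar : ¬ (m = X0 σ ∨ m = -X0 σ) := fun h0 => hside (by
    rcases h0 with rfl | rfl
    · rw [side, side, hy, hσn]
    · rw [side, side, B_neg_left, B_neg_left, hy, hσn])
  have hy0 : B m y.1 ≠ 0 := fun h0 => hpar (hgen m hmn h0)
  -- Genericity of `y` carries over to `σ • y`: translate back by `σ⁻¹`, which fixes `X0 σ`.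
  have hσy0 : B m (σ • y).1 ≠ 0 := fun h0 => hpar (by
    have h2 := hgen _ (mat_mem_normals hmn σ⁻¹) (by rw [B_coe_left, inv_inv]; exact h0)
    have h3 : mat (σ⁻¹ : G) *ᵥ X0 σ = X0 σ := by
      conv_lhs => rw [← hb.fixed]
      exact mat_inv_mulVec _ _
    have h4 : ∀ v, mat (σ⁻¹ : G) *ᵥ m = mat (σ⁻¹ : G) *ᵥ v → m = v := fun v hv => by
      rw [← mat_mulVec_inv (σ : SO21) m, ← Subgroup.coe_inv, hv, Subgroup.coe_inv, mat_mulVec_inv]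
    rcases h2 with h2 | h2
    · exact Or.inl (h4 _ (h2.trans h3.symm))
    · exact Or.inr (h4 _ (by rw [h2, Matrix.mulVec_neg, h3])))
  have hprod : B m y.1 * B m (σ • y).1 ≤ 0 := by
    by_contra h0
    exact hside (side_eq_of_mul_pos (not_le.mp h0))
  have hcont : Continuous fun r => B m (geo (X0 σ) y.1 r) := by
    simp only [B_geo]
    exact (Real.continuous_cosh.mul continuous_const).add
      (Real.continuous_sinh.mul continuous_const)
  have hivt := intermediate_value_uIcc (a := 0) (b := Real.arcosh c) hcont.continuousOn
  rw [Set.uIcc_of_le hb.length_pos.le] at hivt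
  simp only [geo_zero, ← hσy] at hivt
  obtain ⟨r, hr, hr0⟩ := hivt (show (0 : ℝ) ∈ _ from by
    rw [Set.mem_uIcc]
    rcases mul_nonpos_iff.mp hprod with h0 | h0
    · exact Or.inr ⟨h0.2, h0.1⟩
    · exact Or.inl h0)
  simp only at hr0
  obtain ⟨g, rfl⟩ := hmn
  have hX := X0_conj hG h1 g
  refine ⟨⟨g * h * g⁻¹, Hyp.geo hb.unit hy r, isConj_iff.mpr ⟨g, rfl⟩, ?_, ?_, fun h0 => ?_⟩, hX, r,
    ⟨lt_of_le_of_ne hr.1 ?_, lt_of_le_of_ne hr.2 ?_⟩, rfl⟩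
  · rw [mem_axis_iff, hX]
    exact hr0
  · exact mem_axis_iff.mpr (B_geo_normal hy r)
  · have h2 := mem_axis_iff.mpr hy
    rw [← h0, mem_axis_iff, hX] at h2
    exact hy0 h2
  · rintro rfl
    rw [geo_zero] at hr0
    exact hy0 hr0
  · rintro rfl
    rw [← hσy] at hr0
    exact hσy0 hr0

theorem geo_injective {n : V} (hn : B n n = 1) (hny : B n y.1 = 0) :
    Function.Injective (geo n y.1) := fun r t hrt => by
  have := congrArg (B (cr n y.1)) hrt
  rw [B_geo, B_geo, B_comm _ y.1, B_cr_self_right, B_cr_cr_self hn y.B_self hny] at this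
  simpa using this

/-- The open segment from `y` to `σ • y` is a fundamental domain for `σ` on its axis, up to
endpoints that meet no transverse lift. A transverse lift crosses the axis once, so it separates the
ends exactly when it crosses inside. -/
theorem exists_bijective_separating (hG : IsHoledSurfaceGroup G) (h1 : h ≠ 1) (hσ : σ ≠ 1)
    (hb : IsBoost (σ : SO21) (X0 σ) c s) (hy : B (X0 σ) y.1 = 0)
    (hgen : ∀ m ∈ normals h, B m y.1 = 0 → m = X0 σ ∨ m = -X0 σ) :
    ∃ φ : separating h σ y → Intersection h σ, Function.Bijective φ ∧
      ∀ m, (side m.1 (σ • y) - side m.1 y) * B m.1 (X0 σ) = Real.cos (φ m).angle := by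
  choose p hpX r hr hpr using fun m : separating h σ y =>
    exists_crossing_of_separating hG h1 hb hy hgen m.2
  refine ⟨fun m => Quotient.mk (crossingSetoid h σ) (p m), ⟨fun m m' hmm => ?_, fun q => ?_⟩,
    fun m => ?_⟩
  · obtain ⟨k, hk1, hk2⟩ := Quotient.exact hmm
    have h2 : geo (X0 σ) y.1 (r m') = geo (X0 σ) y.1 (r m + k * Real.arcosh c) := by
      rw [← hpr, hk2, ← hb.zpow_mulVec_geo hy, ← hpr, coe_smul_val, Subgroup.coe_zpow]
    have h3 := geo_injective hb.unit hy h2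
    have hl := hb.length_pos
    -- Both parameters lie strictly inside one period, so they cannot differ by a nonzero number of
    -- periods.
    have hk : k = 0 := by
      have e1 : (k : ℝ) < 1 := by
        by_contra h0
        nlinarith [(hr m).1, (hr m').2, not_lt.mp h0]
      have e2 : (-1 : ℝ) < k := by
        by_contra h0
        nlinarith [(hr m).2, (hr m').1, not_lt.mp h0]
      have e3 : k < 1 := by exact_mod_cast e1
      have e4 : -1 < k := by exact_mod_cast e2
      omega
    rw [hk, zpow_zero, one_mul, inv_one, mul_one] at hk1
    exact Subtype.ext (by rw [← hpX, ← hpX, hk1])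
  · induction q using Quotient.inductionOn with
    | _ q =>
      obtain ⟨t, ht⟩ := exists_eq_geo hb.unit hy (mem_axis_iff.mp q.mem_axis)
      obtain ⟨k, u, hu, hk⟩ := hb.exists_zpow_mem_Ico y.1 hy t
      have hq1 : q.lift ≠ 1 := fun h0 => h1 (by
        have := q.isConj
        rwa [h0, isConj_one_left] at this)
      have hX := X0_conj hG hq1 (σ ^ k)
      have hpt : (σ ^ k • q.point).1 = geo (X0 σ) y.1 u := by
        rw [coe_smul_val, ht, Subgroup.coe_zpow, hk]
      have hax : axis (σ ^ k * q.lift * (σ ^ k)⁻¹ : G) ≠ axis (σ : SO21) := fun h0 => by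
        apply q.transverse
        ext x
        rw [mem_axis_iff, ← B_coe_smul (σ ^ k), ← hX, ← mem_axis_iff, h0, mem_axis_iff, mem_axis_iff]
        nth_rw 1 [← hb.zpow_fixed k]
        exact Eq.congr (B_coe_smul (σ ^ k) _ _) rfl
      let q' : Crossing h σ := ⟨σ ^ k * q.lift * (σ ^ k)⁻¹, σ ^ k • q.point,
        q.isConj.trans (isConj_iff.mpr ⟨_, rfl⟩),
        by
          rw [mem_axis_iff, hX, B_coe_smul]
          exact mem_axis_iff.mp q.mem_lift,
        by
          rw [mem_axis_iff, hpt]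
          exact B_geo_normal hy u, hax⟩
      have hqq : Quotient.mk (crossingSetoid h σ) q = Quotient.mk (crossingSetoid h σ) q' :=
        Quotient.sound ⟨k, rfl, rfl⟩
      have hmem : X0 q'.lift ∈ normals h := X0_mem_normals_of_isConj hG h1 q'.isConj
      have h0 : B (X0 q'.lift) (geo (X0 σ) y.1 u) = 0 := by
        rw [← hpt]
        exact mem_axis_iff.mp q'.mem_lift
      have hne : B (X0 q'.lift) (cr (X0 σ) (geo (X0 σ) y.1 u)) ≠ 0 := by
        rw [← hpt]
        exact q'.B_cr_ne_zero hG h1 hσ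
      have hu0 : 0 < u := lt_of_le_of_ne hu.1 fun hu0 => by
        rw [← hu0, geo_zero] at h0
        exact hax (axis_eq_of_X0 (hgen _ hmem h0))
      have hs := side_crossing hb hy ⟨hu0, hu.2⟩ h0 hne
      have hsep : X0 q'.lift ∈ separating h σ y := ⟨hmem, fun h2 => by
        rw [h2, sub_self] at hs
        split_ifs at hs <;> norm_num at hs⟩
      refine ⟨⟨_, hsep⟩, ?_⟩
      rw [hqq]
      exact congrArg _ (Crossing.eq_of_X0_eq hG h1 hσ (hpX ⟨_, hsep⟩))
  · have hX := hpX m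
    have h0 : B m.1 (geo (X0 σ) y.1 (r m)) = 0 := by
      rw [← hpr, ← hX]
      exact mem_axis_iff.mp (p m).mem_lift
    have hne := (p m).B_cr_ne_zero hG h1 hσ
    rw [hX, hpr] at hne
    simp only
    rw [Intersection.cos_angle_mk hG h1 hσ, side_crossing hb hy (hr m) h0 hne, hX, hpr]
    split_ifs <;> ring

end count

theorem finite_intersection (hG : IsHoledSurfaceGroup G) {h σ : G} (h1 : h ≠ 1) (hσ : σ ≠ 1) :
    Finite (Intersection h σ) := by
  obtain ⟨c, s, hb⟩ := hG.exists_isBoost hσ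
  obtain ⟨y, hy, hgen⟩ := exists_generic_mem_axis hG h1 hσ
  obtain ⟨φ, hφ, -⟩ := exists_bijective_separating hG h1 hσ hb hy hgen
  have : Finite (separating h σ y) := finite_side_ne hG h1 y (σ • y)
  exact Finite.of_surjective φ hφ.2

theorem B_jump_eq_finsum_cos (hG : IsHoledSurfaceGroup G) {h σ : G} (h1 : h ≠ 1) (hσ : σ ≠ 1)
    (o : Hyp) : B (jump h o (σ • o)) (X0 σ) = ∑ᶠ p : Intersection h σ, Real.cos p.angle := by
  obtain ⟨c, s, hb⟩ := hG.exists_isBoost hσ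
  obtain ⟨y, hy, hgen⟩ := exists_generic_mem_axis hG h1 hσ
  obtain ⟨φ, hφ, hcos⟩ := exists_bijective_separating hG h1 hσ hb hy hgen
  -- The two cocycles differ by a coboundary, and its pairing with the fixed vector of `σ` vanishes.
  have hbase : B (jump h o (σ • o)) (X0 σ) = B (jump h y (σ • y)) (X0 σ) := by
    rw [jump_add hG h1 o y, jump_add hG h1 y (σ • y) (σ • o), jump_smul hG h1, jump_swap hG h1 o y,
      Matrix.mulVec_neg, B_add_left, B_add_left, B_neg_left]
    have hfix : B (mat σ *ᵥ jump h o y) (X0 σ) = B (jump h o y) (X0 σ) := by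
      conv_lhs => rw [← hb.fixed]
      exact B_mat _ _ _
    rw [hfix]
    ring
  let L : V →+ ℝ :=
    { toFun := fun v => B v (X0 σ)
      map_zero' := B_zero_left _
      map_add' := fun v w => B_add_left v w _ }
  have hL : L (jump h y (σ • y)) =
      ∑ᶠ m ∈ normals h, (side m (σ • y) - side m y) * B m (X0 σ) := by
    rw [jump, L.map_finsum_mem' (finite_support_jump hG h1 y (σ • y))]
    exact finsum_mem_congr rfl fun m _ => B_smul_left _ _ _
  rw [hbase, ← finsum_eq_of_bijective φ hφ hcos]
  change L _ = _
  rw [hL, finsum_set_coe_eq_finsum_mem (separating h σ y)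
    (f := fun m => (side m (σ • y) - side m y) * B m (X0 σ))]
  refine finsum_mem_inter_support_eq' _ _ _ fun m hm =>
    ⟨fun hmn => ⟨hmn, fun h0 => hm ?_⟩, fun h => h.1⟩
  simp [h0]

/-! ### The derivative of the translation length -/

/-- Trace above 3 is an open condition, so near zero the length is arcosh((tr - 1)/2); the factor
`s` in the derivative of the trace cancels against that of arcosh. -/
theorem hasDerivAt_translationLength (hG : IsHoledSurfaceGroup G) {u : G → V}
    {ρ : ℝ → G →* SO21} (hρ : IsDeformationAlong u ρ) {σ : G} (hσ : σ ≠ 1) :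
    HasDerivAt (fun t => translationLength (ρ t σ)) (2 * B (u σ) (X0 σ)) 0 := by
  obtain ⟨c, s, hb⟩ := hG.exists_isBoost hσ
  have h0 : ρ 0 σ = (σ : SO21) := by rw [hρ.initial]; rfl
  have htr : HasDerivAt (fun t => (mat (ρ t σ)).trace) (4 * s * B (u σ) (X0 σ)) 0 := by
    rw [← hb.trace_ad_mul]
    exact HasDerivAt.fun_sum fun i _ => hρ.tangent σ i i
  have hc : ((mat (ρ 0 σ)).trace - 1) / 2 = c := by rw [h0, hb.trace_eq]; ring
  have hev : ∀ᶠ t in nhds (0 : ℝ), 3 < (mat (ρ t σ)).trace :=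
    htr.continuousAt.eventually_const_lt (by beta_reduce; rw [h0, hb.trace_eq]; linarith [hb.one_lt])
  have heq : (fun t => translationLength (ρ t σ)) =ᶠ[nhds 0]
      fun t => Real.arcosh (((mat (ρ t σ)).trace - 1) / 2) := by
    filter_upwards [hev] with t ht
    obtain ⟨n, hn⟩ := exists_isBoost_of_trace ht
    exact hn.translationLength_eq
  refine HasDerivAt.congr_of_eventuallyEq ?_ heq
  have hd := Real.hasDerivAt_arcosh (x := c) hb.one_lt
  rw [show c ^ 2 - 1 = s ^ 2 by linarith [hb.sq_sub_sq], Real.sqrt_sq hb.pos.le] at hd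
  have := HasDerivAt.comp_of_eq (0 : ℝ) hd ((htr.sub_const 1).div_const 2) hc.symm
  refine this.congr_deriv ?_
  have := hb.pos.ne'
  field_simp
  ring

theorem B_sum_left {ι : Type*} (S : Finset ι) (f : ι → V) (v : V) :
    B (∑ i ∈ S, f i) v = ∑ i ∈ S, B (f i) v := by
  let L : V →+ ℝ :=
    { toFun := fun w => B w v
      map_zero' := B_zero_left _
      map_add' := fun w w' => B_add_left w w' _ }
  exact map_sum L f S

end AffineTwist

/-! ### The derivative formula for affine twists -/

open AffineTwist in
theorem mainTheorem5 (G : Subgroup SO21) (hG : IsHoledSurfaceGroup G)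
    (s : ℕ) (h : Fin s → G)
    (hsimple : ∀ k, IsSimple (h k))
    (hseparating : ∀ k, IsSeparating (h k))
    (hdisjoint : Pairwise fun j k => Disjoint (curve (h j)) (curve (h k))) :
    (∀ k, ∃! u : G → V, IsAffineTwist (h k) u) ∧
    ∀ AT : Fin s → G → V, (∀ k, IsAffineTwist (h k) (AT k)) →
    ∀ (τ : Fin s → ℝ) (ρ : ℝ → G →* SO21),
      IsDeformationAlong (fun g => ∑ k, τ k • AT k g) ρ →
    ∀ σ : G, σ ≠ 1 →
      (∀ k, Finite (Intersection (h k) σ)) ∧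
      HasDerivAt (fun t => translationLength (ρ t σ))
        (2 * ∑ k, τ k * ∑ᶠ p : Intersection (h k) σ, Real.cos p.angle) 0 := by
  -- Each curve gets its own base point to the right of its axis; no common one is needed, since the
  -- pairing with `X0 σ` does not depend on it.
  choose o ho using fun k => (exists_adjacent hG (hsimple k)).2
  have hjump := fun k => isAffineTwist_jump hG (hsimple k) (ho k)
  refine ⟨fun k => ⟨_, hjump k, fun v hv => hv.unique hG (hsimple k) (hseparating k) (hjump k)⟩, ?_⟩
  intro AT hAT τ ρ hρ σ hσ
  refine ⟨fun k => finite_intersection hG (hsimple k).ne_one hσ, ?_⟩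
  have hd := hasDerivAt_translationLength hG hρ hσ
  have e : B (∑ k, τ k • AT k σ) (X0 σ) =
      ∑ k, τ k * ∑ᶠ p : Intersection (h k) σ, Real.cos p.angle := by
    rw [B_sum_left]
    refine Finset.sum_congr rfl fun k _ => ?_
    rw [B_smul_left, (hAT k).unique hG (hsimple k) (hseparating k) (hjump k),
      B_jump_eq_finsum_cos hG (hsimple k).ne_one hσ]
  rw [← e]
  exact hd
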